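/- A topological space $X$ is \emph{monotonically normal} if there is a function $H$ assigning to every pair $(p,U)$, with $U\subseteq X$ open and $p\in U$, an open set $H(p,U)$ such that 1. $p\in H(p,U)\subseteq U$; 2. if $p\in U$, $q\in V$ ($U,V$ open), $p\notin V$ and $q\notin U$, then $H(p,U)\cap H(q,V)=\emptyset$; 3. if $p\in V\subseteq U$ ($U,V$ open), then $H(p,V)\subseteq H(p,U)$. For a cardinal $\chi$, let $H(\chi)$ be the collection of all sets that are hereditarily of cardinality $<\chi$, regarded as a structure $(H(\chi),\in)$ for the first-order language of set theory. **Theorem 3.1.** Let $\chi$ be an uncountable regular cardinal, let $X=(X,\tau)$ be a separable monotonically normal compact Hausdorff space, and let $M$ be a countable elementary submodel of $H(\chi)$ with $(X,\tau)\in M$. For $x,y\in X$ write $x=_M y$ if $f(x)=f(y)$ for every continuous function $f:X\to\mathbb R$ with $f\in M$ (a function being its set of ordered pairs, and a real number being its Dedekind cut in the rationals). Then every equivalence class of the equivalence relation $=_M$ on $X$ has at most $2$ points. -/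

import Mathlib

universe u

noncomputable section

namespace SubmodelTop

/-! ### Monotone normality -/

/-- `H` is a monotone normality operator on `X`. The operator is only meaningful on pairs `(p, U)`
with `U` open and `p ∈ U`; its values elsewhere are irrelevant. -/
structure IsMonotoneNormalityOperator {X : Type*} [TopologicalSpace X]
    (H : X → Set X → Set X) : Prop where
  isOpen : ∀ p U, IsOpen U → p ∈ U → IsOpen (H p U)
  mem : ∀ p U, IsOpen U → p ∈ U → p ∈ H p U
  subset : ∀ p U, IsOpen U → p ∈ U → H p U ⊆ U
  disjoint : ∀ p q U V, IsOpen U → p ∈ U → IsOpen V → q ∈ V → p ∉ V → q ∉ U →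
    Disjoint (H p U) (H q V)
  mono : ∀ p U V, IsOpen U → IsOpen V → p ∈ V → V ⊆ U → H p V ⊆ H p U

/-- A space is monotonically normal if it has a monotone normality operator. -/
def MonotonicallyNormal (X : Type*) [TopologicalSpace X] : Prop :=
  ∃ H : X → Set X → Set X, IsMonotoneNormalityOperator H

/-! ### The structure `(H(χ), ∈)` -/

/-- The only symbol of the language of set theory: a binary relation symbol. -/
inductive SetRel : ℕ → Type
  | mem : SetRel 2

/-- The first-order language of set theory. -/
def setLang : FirstOrder.Language := ⟨fun _ => Empty, SetRel⟩

/-- `H(χ)`: the collection of all sets that are hereditarily of cardinality less than `χ`. -/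
def HSet (χ : Cardinal.{u}) : Set ZFSet.{u} :=
  {a | ZFSet.Hereditarily (fun b => b.card < χ) a}

/-- `H(χ)` as a structure for the language of set theory, with the true membership relation. -/
instance instStructureHSet (χ : Cardinal.{u}) : setLang.Structure (HSet χ) where
  funMap := fun f _ => nomatch f
  RelMap := fun r v => match r, v with
    | SetRel.mem, v => (v 0 : ZFSet.{u}) ∈ (v 1 : ZFSet.{u})

/-- The collection of sets that are elements of the submodel `M` of `H(χ)`. -/
def elems {χ : Cardinal.{u}} (M : setLang.ElementarySubstructure (HSet χ)) : Set ZFSet.{u} :=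
  Subtype.val '' (M : Set (HSet χ))

/-! ### Topological spaces and real-valued functions as sets

The underlying set of a space is a ZFC set `X`, whose type of elements carries a topology. -/

/-- The topology of `X`, as a set: the set of all open subsets of `X`. -/
def topologySet (X : ZFSet.{u}) [TopologicalSpace X] : ZFSet.{u} :=
  ZFSet.sep (fun U => IsOpen {x : X | (x : ZFSet.{u}) ∈ U}) (ZFSet.powerset X)

/-- The topological space `X` as a set: the ordered pair of its underlying set and its topology. -/
def spaceSet (X : ZFSet.{u}) [TopologicalSpace X] : ZFSet.{u} :=
  ZFSet.pair X (topologySet X)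

/-- The natural number `n` as a finite von Neumann ordinal. -/
def natSet (n : ℕ) : ZFSet.{u} := Ordinal.toZFSet (n : Ordinal.{u})

/-- The real number `r` as a set, namely as its Dedekind cut: the set of all rationals below `r`,
where a rational is presented as `(a - b) / (c + 1)` by the triple `(a, (b, c))` of natural numbers.
(All presentations of a rational are used, which makes passing to quotients unnecessary.) -/
def realSet (r : ℝ) : ZFSet.{u} :=
  ZFSet.range fun t : {t : ℕ × ℕ × ℕ // ((t.1 : ℝ) - (t.2.1 : ℝ)) / ((t.2.2 : ℝ) + 1) < r} =>
    ZFSet.pair (natSet t.1.1) (ZFSet.pair (natSet t.1.2.1) (natSet t.1.2.2))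

/-- A function `f : X → ℝ` as a set, namely the set of all ordered pairs `(x, f(x))`. -/
def funSet {X : ZFSet.{u}} (f : X → ℝ) : ZFSet.{u} :=
  ZFSet.range fun x : X => ZFSet.pair (x : ZFSet.{u}) (realSet (f x))

/-! ### `M`-equivalence -/

/-- The relation `=_M` on `X`: two points are equivalent if every continuous real-valued function
on `X` that is an element of `M` takes the same value at both. -/
def modelSetoid {χ : Cardinal.{u}} (M : setLang.ElementarySubstructure (HSet χ))
    (X : ZFSet.{u}) [TopologicalSpace X] : Setoid X where
  r x y := ∀ f : X → ℝ, Continuous f → funSet f ∈ elems M → f x = f y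
  iseqv :=
    { refl := fun _ _ _ _ => rfl
      symm := fun h f hf hM => (h f hf hM).symm
      trans := fun h₁ h₂ f hf hM => (h₁ f hf hM).trans (h₂ f hf hM) }

end SubmodelTop

end

/-!
A countable family of functions in `M` already identifies no three points. The reason splits into a
topological fact and one application of elementarity.

*Topology.* Let `H` be a monotone normality operator on a separable space `X`, and `D` a countable
dense set. If `H(p, U)` and `H(q, V)` have a point in common, then `p ∈ V` or `q ∈ U`. First, `X` is
hereditarily Lindelöf (`IsMonotoneNormalityOperator.hereditarilyLindelofSpace`), since in a
right-separated `ω₁`-sequence uncountably many of the sets `H(x_j, U_j)` share a point of `D`.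
Second, if `X` is compact, some countable family of open sets splits every triple of distinct points
(`IsMonotoneNormalityOperator.exists_countable_splitting`). Otherwise every countable family leaves
a triple unsplit. Choose disjoint neighbourhoods `P_i` of the points `t_i` of a triple `t`, put
`W_i(t) = H(t_i, P_i)`, and call `t` good if `d_i ∈ H(t_i, W_i(t))` for each `i < 3`, where the
points `d_i` of `D` are fixed. Two good triples `s`, `t` satisfy `t_i ∈ W_i(s)` or `s_i ∈ W_i(t)` for
each of the three indices. A sufficiently closed countable family `𝒜` leaves some good `t` unsplit and
supplies a good `s` for which each alternative happens for at most one index: the `W_i(s)` are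
disjoint members of `𝒜`, which do not split `t`; and by compactness the sets `W_i(t)`, away from
a neighbourhood `V ∈ 𝒜` of `t` that misses `s`, are covered by members `O_i` of `𝒜` that do not
split `s` and are disjoint from the other `W_j(t)`. Two alternatives cannot serve three indices.

*Elementarity.* Hence there is a sequence of continuous functions `X → ℝ` no three distinct points
being identified by all of them (`exists_seq_continuous_splitting`). A single set `R` in `H(χ)` encodes
such a sequence, and "`R` encodes such a sequence" is definable from the space, once the order of
the rationals is (`exists_ratLt_mem`). So `M` contains such an `R`, and with it each
function of the sequence, which gives `exists_ne_of_mem`.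
-/

noncomputable section

namespace SubmodelTop

/-! ### Separable monotonically normal spaces are hereditarily Lindelöf -/

section Topology

variable {X : Type*} [TopologicalSpace X]

/-- A point `q` outside `U` is kept away from `H(p, U)` by its neighbourhood `H(q, {p}ᶜ)`. -/
theorem IsMonotoneNormalityOperator.closure_subset [T1Space X] {H : X → Set X → Set X}
    (hH : IsMonotoneNormalityOperator H) {p : X} {U : Set X} (hU : IsOpen U) (hp : p ∈ U) :
    closure (H p U) ⊆ U := by
  intro q hq
  by_contra hqU
  have hqp : q ∈ ({p}ᶜ : Set X) := fun h => hqU (h ▸ hp)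
  have ho : IsOpen ({p}ᶜ : Set X) := isOpen_compl_singleton
  obtain ⟨z, hz1, hz2⟩ := mem_closure_iff.1 hq _ (hH.isOpen q _ ho hqp) (hH.mem q _ ho hqp)
  exact Set.disjoint_left.1 (hH.disjoint q p _ _ ho hqp hU hp hqU (by simp)) hz1 hz2

theorem exists_not_countable_fiber {ι α : Type*} {A : Set ι} (hA : ¬ A.Countable) {D : Set α}
    (hD : D.Countable) (d : ι → α) (hd : ∀ i, d i ∈ D) :
    ∃ a ∈ D, ¬ {i ∈ A | d i = a}.Countable := by
  by_contra! h
  refine hA ((hD.biUnion h).mono fun i hi => ?_)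
  exact Set.mem_biUnion (hd i) ⟨hi, rfl⟩

/-- A separable monotonically normal space has no right-separated sequence of length `ω₁`; here
`W` stands for `ω₁`. A point `d` of the dense set common to `H(x_j, H(x_j, U_j))` for uncountably
many `j` forces the closure of each initial segment of these `x_j` into some `U_γ`; removing these
closures from the `U_j` yields uncountably many pairwise disjoint open sets. -/
theorem IsMonotoneNormalityOperator.not_rightSeparated [T1Space X]
    [TopologicalSpace.SeparableSpace X] {H : X → Set X → Set X}
    (hH : IsMonotoneNormalityOperator H) {W : Type*} [LinearOrder W]
    (hW : ¬ (Set.univ : Set W).Countable) (hIio : ∀ i : W, (Set.Iio i).Countable)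
    (x : W → X) (U : W → Set X) (hU : ∀ i, IsOpen (U i)) (hx : ∀ i, x i ∈ U i)
    (hsep : ∀ i j, i < j → x j ∉ U i) : False := by
  obtain ⟨D, hDc, hD⟩ := TopologicalSpace.exists_countable_dense X
  have hunb : ∀ A : Set W, ¬ A.Countable → ∀ γ, ∃ β ∈ A, γ < β := by
    intro A hA γ
    by_contra! h
    refine hA (((hIio γ).union (Set.countable_singleton γ)).mono fun i hi => ?_)
    rcases (h i hi).lt_or_eq with h | h
    · exact Or.inl h
    · exact Or.inr h
  have hpick : ∀ p V, IsOpen V → p ∈ V → ∃ d ∈ D, d ∈ H p V := fun p V hV hp =>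
    let ⟨d, h1, h2⟩ := hD.exists_mem_open (hH.isOpen p V hV hp) ⟨p, hH.mem p V hV hp⟩
    ⟨d, h1, h2⟩
  have hW1 : ∀ j, IsOpen (H (x j) (U j)) := fun j => hH.isOpen _ _ (hU j) (hx j)
  have hW2 : ∀ j, x j ∈ H (x j) (U j) := fun j => hH.mem _ _ (hU j) (hx j)
  choose d hdD hd using fun j => hpick (x j) _ (hW1 j) (hW2 j)
  obtain ⟨a, -, hA⟩ := exists_not_countable_fiber hW hDc d hdD
  set A : Set W := {i | i ∈ Set.univ ∧ d i = a} with hAdef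
  have hmem : ∀ i ∈ A, ∀ j ∈ A, i < j → x i ∈ H (x j) (U j) := by
    intro i hi j hj hij
    by_contra hcon
    refine Set.disjoint_left.1 (hH.disjoint _ _ _ _ (hW1 i) (hW2 i) (hW1 j) (hW2 j) hcon
      fun h => hsep i j hij (hH.subset _ _ (hU i) (hx i) h))
      (?_ : a ∈ _) ?_
    · have := hd i; rwa [hi.2] at this
    · have := hd j; rwa [hj.2] at this
  choose n hnA hn using hunb A hA
  -- As `hF` shows, beyond `n γ` the points indexed by `A` avoid the closure of the segment below `γ`.
  let F : W → Set X := fun γ => closure (x '' {i | i ∈ A ∧ i < γ})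
  have hF : ∀ γ, F γ ⊆ U (n γ) := fun γ => by
    refine (closure_mono ?_).trans (hH.closure_subset (hU (n γ)) (hx _))
    rintro _ ⟨i, ⟨hiA, hi⟩, rfl⟩
    exact hmem i hiA _ (hnA γ) (hi.trans (hn γ))
  have hO : ∀ γ, IsOpen (U (n (n γ)) \ F γ) := fun γ => (hU _).sdiff isClosed_closure
  have hxO : ∀ γ, x (n (n γ)) ∈ U (n (n γ)) \ F γ := fun γ =>
    ⟨hx _, fun h => hsep _ _ (hn (n γ)) (hF γ h)⟩
  -- Two indices `γ < γ'` with the same `e` contradict disjointness, as `x (n (n γ))` is in `F γ'`.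
  choose e heD he using fun γ => hpick _ _ (hO γ) (hxO γ)
  obtain ⟨b, -, hB⟩ := exists_not_countable_fiber hW hDc e heD
  obtain ⟨γ, hγ⟩ : {i | i ∈ Set.univ ∧ e i = b}.Nonempty :=
    Set.nonempty_iff_ne_empty.2 fun h => hB (h ▸ Set.countable_empty)
  obtain ⟨γ', hγ', hlt⟩ := hunb _ hB (n (n γ))
  refine Set.disjoint_left.1 (hH.disjoint _ _ _ _ (hO γ) (hxO γ) (hO γ') (hxO γ')
    (fun h => h.2 (subset_closure ⟨_, ⟨hnA _, hlt⟩, rfl⟩))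
    (fun h => hsep _ _ (hlt.trans ((hn γ').trans (hn _))) h.1)) (?_ : b ∈ _) ?_
  · have := he γ; rwa [hγ.2] at this
  · have := he γ'; rwa [hγ'.2] at this

/-- From an open cover without countable subcover a right-separated sequence of length `ω₁` is chosen
by recursion. -/
theorem IsMonotoneNormalityOperator.hereditarilyLindelofSpace [T1Space X]
    [TopologicalSpace.SeparableSpace X] {H : X → Set X → Set X}
    (hH : IsMonotoneNormalityOperator H) : HereditarilyLindelofSpace X := by
  refine .of_forall_isOpen fun s _ => isLindelof_of_countable_subcover fun {ι} U hU hs => ?_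
  by_contra! hcon
  have hidx : ∀ y : s, ∃ i, (y : X) ∈ U i := fun y => Set.mem_iUnion.1 (hs y.2)
  choose idx hidx using hidx
  have hpt : ∀ C : Set s, C.Countable → ∃ p : s, ∀ y ∈ C, (p : X) ∉ U (idx y) := by
    intro C hC
    obtain ⟨p, hp, hpC⟩ := Set.not_subset.1 (hcon (idx '' C) (hC.image _))
    refine ⟨⟨p, hp⟩, fun y hy h => hpC ?_⟩
    exact Set.mem_biUnion (Set.mem_image_of_mem idx hy) h
  have hpt' : ∀ C : Set s, ∃ p : s, C.Countable → ∀ y ∈ C, (p : X) ∉ U (idx y) := fun C => by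
    by_cases hC : C.Countable
    · exact (hpt C hC).imp fun p h _ => h
    · exact (hpt ∅ Set.countable_empty).imp fun p _ h => absurd h hC
  choose p hp using hpt'
  let W := (Cardinal.aleph.{0} 1).ord.ToType
  have hIio : ∀ i : W, (Set.Iio i).Countable := fun i => by
    have := Cardinal.mk_Iio_lt i (by simp [W])
    rwa [Cardinal.mk_ord_toType, Cardinal.lt_aleph_one_iff,
      Cardinal.le_aleph0_iff_set_countable] at this
  have hW : ¬ (Set.univ : Set W).Countable := fun h => by
    have h1 := (Cardinal.le_aleph0_iff_set_countable).2 h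
    rw [Cardinal.mk_univ, Cardinal.mk_ord_toType, ← Cardinal.lt_aleph_one_iff] at h1
    exact lt_irrefl _ h1
  let F : (j : W) → ((i : W) → i < j → s) → s := fun j f =>
    p (Set.range fun i : Set.Iio j => f i i.2)
  let x : W → s := WellFounded.fix (r := (· < ·)) wellFounded_lt F
  have hx : ∀ j, x j = p (Set.range fun i : Set.Iio j => x i) := fun j =>
    WellFounded.fix_eq _ F j
  refine hH.not_rightSeparated hW hIio (fun j => (x j : X)) (fun j => U (idx (x j)))
    (fun j => hU _) (fun j => hidx _) fun i j hij => ?_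
  have := hIio j
  have hc : (Set.range fun i : Set.Iio j => x i).Countable :=
    have := this.to_subtype
    Set.countable_range _
  have h := hp _ hc (x i) ⟨⟨i, hij⟩, rfl⟩
  rwa [← hx j] at h

end Topology

/-! ### A countable family of open sets splitting all triples -/

section Topology

variable {X : Type*} [TopologicalSpace X]

/-- The family `𝒜` does not split the triple `t`: each member of `𝒜` contains all of the three
points or none of them. -/
def Unsplit {X : Type*} (𝒜 : Set (Set X)) (t : Fin 3 → X) : Prop :=
  ∀ V ∈ 𝒜, ∀ i j, t i ∈ V → t j ∈ V

theorem Unsplit.mono {X : Type*} {𝒜 ℬ : Set (Set X)} {t : Fin 3 → X} (h : Unsplit ℬ t)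
    (hAB : 𝒜 ⊆ ℬ) : Unsplit 𝒜 t :=
  fun V hV => h V (hAB hV)

/-- Closing off: a countable set can be enlarged to a countable set closed under a finitary operation
with countable sets as values. -/
theorem exists_countable_closed_under {α : Type*} {k : ℕ} (op : (Fin k → α) → Set α)
    (hop : ∀ v, (op v).Countable) {A₀ : Set α} (h₀ : A₀.Countable) :
    ∃ A : Set α, A.Countable ∧ A₀ ⊆ A ∧ ∀ v, (∀ i, v i ∈ A) → op v ⊆ A := by
  let step : Set α → Set α := fun A => A ∪ ⋃ v ∈ {v : Fin k → α | ∀ i, v i ∈ A}, op v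
  let B : ℕ → Set α := fun n => step^[n] A₀
  have hB : ∀ n, B (n + 1) = step (B n) := fun n => Function.iterate_succ_apply' _ _ _
  have hmono : Monotone B := monotone_nat_of_le_succ fun n => by
    rw [hB]; exact Set.subset_union_left
  refine ⟨⋃ n, B n, Set.countable_iUnion fun n => ?_, Set.subset_iUnion B 0, fun v hv => ?_⟩
  · induction n with
    | zero => exact h₀
    | succ n ih =>
      rw [hB]
      exact ih.union ((Set.countable_pi fun _ => ih).biUnion fun v _ => hop v)
  · have h : ∀ i, ∃ n, v i ∈ B n := fun i => Set.mem_iUnion.1 (hv i)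
    choose n hn using h
    refine Set.Subset.trans ?_ (Set.subset_iUnion B (Finset.univ.sup n + 1))
    rw [hB]
    refine Set.Subset.trans ?_ Set.subset_union_right
    exact Set.subset_biUnion_of_mem (u := op) (x := v)
      fun i => hmono (Finset.le_sup (Finset.mem_univ i)) (hn i)

theorem exists_seq_isOpen_closure_subset [HereditarilyLindelofSpace X] [RegularSpace X] {U : Set X}
    (hU : IsOpen U) :
    ∃ s : ℕ → Set X, (∀ n, IsOpen (s n)) ∧ (∀ n, closure (s n) ⊆ U) ∧ U ⊆ ⋃ n, s n := by
  have h : ∀ x : U, ∃ V : Set X, IsOpen V ∧ (x : X) ∈ V ∧ closure V ⊆ U := fun x => by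
    obtain ⟨C, hC, hCc, hCU⟩ := exists_mem_nhds_isClosed_subset (hU.mem_nhds x.2)
    exact ⟨interior C, isOpen_interior, mem_interior_iff_mem_nhds.2 hC,
      (closure_minimal interior_subset hCc).trans hCU⟩
  choose V hVo hxV hVU using h
  rcases isEmpty_or_nonempty U with hE | hE
  · refine ⟨fun _ => ∅, fun _ => isOpen_empty, fun _ => by simp, ?_⟩
    rw [Set.isEmpty_coe_sort.1 hE]
    exact Set.empty_subset _
  · obtain ⟨f, hf⟩ := eq_open_union_nat V hVo
    refine ⟨fun n => V (f n), fun n => hVo _, fun n => hVU _, ?_⟩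
    rw [hf]
    exact fun x hx => Set.mem_iUnion.2 ⟨⟨x, hx⟩, hxV ⟨x, hx⟩⟩

theorem exists_disjoint_open_nhds [T2Space X] {ι : Type*} [Finite ι] {t : ι → X}
    (ht : Function.Injective t) :
    ∃ P : ι → Set X, (∀ i, IsOpen (P i)) ∧ (∀ i, t i ∈ P i) ∧
      ∀ i j, i ≠ j → Disjoint (P i) (P j) := by
  obtain ⟨U, hU, hd⟩ := (Set.finite_range t).t2_separation
  exact ⟨fun i => U (t i), fun i => (hU _).2, fun i => (hU _).1, fun i j hij =>
    hd ⟨i, rfl⟩ ⟨j, rfl⟩ (ht.ne hij)⟩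

/-- A separable monotonically normal compactum has a countable family of open sets splitting every
triple of distinct points. Suppose not. Then good triples `t` and `s`, both sharing the points `d i`
with the sets `H(t_i, W_i(t))` and `H(s_i, W_i(s))`, are found such that `t_i ∈ W_i(s)` for at most one
`i` and `s_i ∈ W_i(t)` for at most one `i`; some third index violates the defining property of `H`. -/
theorem IsMonotoneNormalityOperator.exists_countable_splitting [T2Space X] [CompactSpace X]
    [TopologicalSpace.SeparableSpace X] {H : X → Set X → Set X}
    (hH : IsMonotoneNormalityOperator H) :
    ∃ 𝒜 : Set (Set X), 𝒜.Countable ∧ (∀ U ∈ 𝒜, IsOpen U) ∧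
      ∀ t : Fin 3 → X, Function.Injective t → ¬ Unsplit 𝒜 t := by
  have := hH.hereditarilyLindelofSpace
  by_contra! hcon
  obtain ⟨D, hDc, hD⟩ := TopologicalSpace.exists_countable_dense X
  have : Countable D := hDc.to_subtype
  have hP : ∀ t : Fin 3 → X, ∃ P : Fin 3 → Set X, Function.Injective t →
      (∀ i, IsOpen (P i)) ∧ (∀ i, t i ∈ P i) ∧ ∀ i j, i ≠ j → Disjoint (P i) (P j) := fun t => by
    by_cases ht : Function.Injective t
    · exact (exists_disjoint_open_nhds ht).imp fun _ h _ => h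
    · exact ⟨fun _ => ∅, fun h => absurd h ht⟩
  choose P hP using hP
  let W : (Fin 3 → X) → Fin 3 → Set X := fun t i => H (t i) (P t i)
  have hWo : ∀ t, Function.Injective t → ∀ i, IsOpen (W t i) := fun t ht i =>
    hH.isOpen _ _ ((hP t ht).1 i) ((hP t ht).2.1 i)
  have htW : ∀ t, Function.Injective t → ∀ i, t i ∈ W t i := fun t ht i =>
    hH.mem _ _ ((hP t ht).1 i) ((hP t ht).2.1 i)
  have hWP : ∀ t, Function.Injective t → ∀ i, W t i ⊆ P t i := fun t ht i =>
    hH.subset _ _ ((hP t ht).1 i) ((hP t ht).2.1 i)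
  let Good : (Fin 3 → D) → (Fin 3 → X) → Prop := fun d t =>
    Function.Injective t ∧ ∀ i, (d i : X) ∈ H (t i) (W t i)
  let CO : Set (Set X) → Prop := fun 𝒜 => 𝒜.Countable ∧ ∀ U ∈ 𝒜, IsOpen U
  -- One triple `d` of points of `D` works for all countable families simultaneously.
  obtain ⟨d, hd⟩ : ∃ d, ∀ 𝒜, CO 𝒜 → ∃ t, Good d t ∧ Unsplit 𝒜 t := by
    by_contra! h
    choose 𝒜 h𝒜 hbad using h
    have hc : CO (⋃ d, 𝒜 d) :=
      ⟨Set.countable_iUnion fun d => (h𝒜 d).1, fun U hU => by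
        obtain ⟨i, hi⟩ := Set.mem_iUnion.1 hU
        exact (h𝒜 i).2 U hi⟩
    obtain ⟨t, ht, htu⟩ := hcon _ hc.1 hc.2
    have : ∀ i, ∃ a : D, (a : X) ∈ H (t i) (W t i) := fun i => by
      obtain ⟨a, h1, h2⟩ := hD.exists_mem_open (hH.isOpen _ _ (hWo t ht i) (htW t ht i))
        ⟨_, hH.mem _ _ (hWo t ht i) (htW t ht i)⟩
      exact ⟨⟨a, h1⟩, h2⟩
    choose a ha using this
    exact hbad a t ⟨ht, ha⟩ (htu.mono (Set.subset_iUnion 𝒜 a))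
  -- A set is small if some countable family leaves no good triple meeting the set unsplit.
  let Small : Set X → Prop := fun U => ∃ 𝒜, CO 𝒜 ∧ ∀ t, Good d t → Unsplit 𝒜 t → ∀ i, t i ∉ U
  -- By the hereditary Lindelöf property, the union of all small open sets is avoided by all good
  -- triples that are unsplit by a single countable family.
  obtain ⟨𝒜₀, h𝒜₀, hsmall⟩ : ∃ 𝒜₀, CO 𝒜₀ ∧ ∀ t, Good d t → Unsplit 𝒜₀ t →
      ∀ U, IsOpen U → Small U → ∀ i, t i ∉ U := by
    let ι := {U : Set X // IsOpen U ∧ Small U}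
    choose 𝒜 h𝒜 hav using fun U : ι => U.2.2
    obtain ⟨I, hI, hIU⟩ := eq_open_union_countable (fun U : ι => (U : Set X)) fun U => U.2.1
    refine ⟨⋃ U ∈ I, 𝒜 U, ?_, fun t ht htu U hU hUs i hi => ?_⟩
    · refine ⟨hI.biUnion fun i _ => (h𝒜 i).1, fun U hU => ?_⟩
      obtain ⟨i, -, hi⟩ := Set.mem_iUnion₂.1 hU
      exact (h𝒜 i).2 U hi
    · have hmem : t i ∈ ⋃ U : ι, (U : Set X) := Set.mem_iUnion.2 ⟨⟨U, hU, hUs⟩, hi⟩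
      rw [← hIU] at hmem
      obtain ⟨V, hV, hVt⟩ := Set.mem_iUnion₂.1 hmem
      exact hav V t ht (htu.mono (Set.subset_biUnion_of_mem (u := 𝒜) hV)) i hVt
  -- No neighbourhood of a point `z i` is small. Every sufficiently closed family separates `t` from
  -- `z 0` or `z 1`, which leaves room for the triple `s` away from `t`.
  obtain ⟨z, hz, hzu⟩ := hd 𝒜₀ h𝒜₀
  -- The operations under which the decisive family is closed.
  have hshr : ∀ U : Set X, ∃ s : ℕ → Set X, IsOpen U →
      (∀ n, IsOpen (s n)) ∧ (∀ n, closure (s n) ⊆ U) ∧ U ⊆ ⋃ n, s n := fun U => by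
    by_cases hU : IsOpen U
    · exact (exists_seq_isOpen_closure_subset hU).imp fun _ h _ => h
    · exact ⟨fun _ => ∅, fun h => absurd h hU⟩
  choose shr hshr using hshr
  have hcov : ∀ V V' : Set X, ∃ F : Finset X, IsOpen V → closure V' ⊆ V →
      (∀ y ∈ F, y ∉ V) ∧ Vᶜ ⊆ ⋃ y ∈ F, H y (closure V')ᶜ := fun V V' => by
    by_cases hV : IsOpen V ∧ closure V' ⊆ V
    · have ho : IsOpen (closure V')ᶜ := isClosed_closure.isOpen_compl
      have hy : ∀ y ∈ Vᶜ, y ∈ (closure V')ᶜ := fun y hy h => hy (hV.2 h)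
      obtain ⟨F, hF⟩ := hV.1.isClosed_compl.isCompact.elim_nhds_subcover
        (fun y => H y (closure V')ᶜ) fun y hyV =>
          (hH.isOpen _ _ ho (hy y hyV)).mem_nhds (hH.mem _ _ ho (hy y hyV))
      exact ⟨F, fun _ _ => hF⟩
    · exact ⟨∅, fun h1 h2 => absurd ⟨h1, h2⟩ hV⟩
  choose F hF using hcov
  let Q : (Fin 4 → Set X) → (Fin 3 → X) → Prop := fun v s =>
    Good d s ∧ (∀ i, s i ∉ v 0) ∧ ∀ i : Fin 3, ∀ j k, s j ∈ v i.succ → s k ∈ v i.succ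
  have hop₃ : ∀ v : Fin 4 → Set X, ∃ C : Set (Set X), C.Countable ∧
      ((∃ s, Q v s) → ∃ s, Q v s ∧ ∀ i, W s i ∈ C) := fun v => by
    by_cases h : ∃ s, Q v s
    · obtain ⟨s, hs⟩ := h
      exact ⟨Set.range (W s), Set.countable_range _, fun _ => ⟨s, hs, fun i => ⟨i, rfl⟩⟩⟩
    · exact ⟨∅, Set.countable_empty, fun h' => absurd h' h⟩
  choose op₃ hop₃c hop₃ using hop₃
  let un : Set X → Set X → Set X → Set X := fun V V' G => ⋃ y ∈ G, H y (closure V')ᶜ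
  -- The values of `op` at `v`: open sets exhausting `v 0` and the exteriors of these sets, the
  -- unions of the sets covering the complement of `v 0` by `hcov`, and the sets `W s i` for one triple
  -- `s` outside `v 0` not split by the other three sets.
  let op : (Fin 4 → Set X) → Set (Set X) := fun v =>
    Set.range (shr (v 0)) ∪ Set.range (fun n => (closure (shr (v 0) n))ᶜ) ∪
      un (v 0) (v 1) '' 𝒫 (F (v 0) (v 1) : Set X) ∪ op₃ v
  have hopc : ∀ v, (op v).Countable := fun v =>
    (((Set.countable_range _).union (Set.countable_range _)).union
      (((F (v 0) (v 1)).finite_toSet.powerset.countable).image _)).union (hop₃c v)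
  obtain ⟨hPzo, hzP, hPzd⟩ := hP z hz.1
  obtain ⟨𝒞, h𝒞c, h𝒞₀, h𝒞op⟩ := exists_countable_closed_under op hopc
    (h𝒜₀.1.union (Set.countable_singleton (P z 0)))
  let 𝒜 : Set (Set X) := {U | U ∈ 𝒞 ∧ IsOpen U}
  have h𝒜 : CO 𝒜 := ⟨h𝒞c.mono fun _ h => h.1, fun _ h => h.2⟩
  have h𝒜op : ∀ v : Fin 4 → Set X, (∀ i, v i ∈ 𝒜) → ∀ U ∈ op v, IsOpen U → U ∈ 𝒜 :=
    fun v hv U hU hUo => ⟨h𝒞op v (fun i => (hv i).1) hU, hUo⟩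
  have h𝒜shr : ∀ U ∈ 𝒜, ∀ n, shr U n ∈ 𝒜 := fun U hU n =>
    h𝒜op (fun _ => U) (fun _ => hU) _ (Or.inl (Or.inl (Or.inl ⟨n, rfl⟩))) ((hshr U hU.2).1 n)
  have h𝒜shr' : ∀ U ∈ 𝒜, ∀ n, (closure (shr U n))ᶜ ∈ 𝒜 := fun U hU n =>
    h𝒜op (fun _ => U) (fun _ => hU) _ (Or.inl (Or.inl (Or.inr ⟨n, rfl⟩)))
      isClosed_closure.isOpen_compl
  have hP0 : P z 0 ∈ 𝒜 := ⟨h𝒞₀ (Or.inr rfl), hPzo 0⟩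
  obtain ⟨t, ht, htu⟩ := hd 𝒜 h𝒜
  obtain ⟨hPto, htP, hPtd⟩ := hP t ht.1
  -- `t` and some `z k` are separated by a member of `𝒜`.
  obtain ⟨V, hV, htV, k, hzV⟩ : ∃ V ∈ 𝒜, t 0 ∈ V ∧ ∃ k, z k ∉ closure V := by
    obtain ⟨ho, hcl, hsub⟩ := hshr _ hP0.2
    by_cases h0 : t 0 ∈ P z 0
    · obtain ⟨n, hn⟩ := Set.mem_iUnion.1 (hsub h0)
      refine ⟨_, h𝒜shr _ hP0 n, hn, 1, fun h => ?_⟩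
      exact Set.disjoint_left.1 (hPzd 0 1 (by decide)) (hcl n h) (hzP 1)
    · obtain ⟨n, hn⟩ := Set.mem_iUnion.1 (hsub (hzP 0))
      refine ⟨_, h𝒜shr' _ hP0 n, fun h => h0 (hcl n h), 0, fun h => ?_⟩
      obtain ⟨y, hy1, hy2⟩ := mem_closure_iff.1 h _ (ho n) hn
      exact hy2 (subset_closure hy1)
  obtain ⟨n, hn⟩ := Set.mem_iUnion.1 ((hshr V hV.2).2.2 htV)
  set V' := shr V n with hV'
  have hV'𝒜 : V' ∈ 𝒜 := h𝒜shr V hV n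
  have hV'V : closure V' ⊆ V := (hshr V hV.2).2.1 n
  have htV' : ∀ i, t i ∈ V' := fun i => htu V' hV'𝒜 0 i hn
  obtain ⟨hFV, hFc⟩ := hF V V' hV.2 hV'V
  have hyV' : ∀ y ∈ F V V', y ∈ (closure V')ᶜ := fun y hy h => hFV y hy (hV'V h)
  have hV'o : IsOpen (closure V')ᶜ := isClosed_closure.isOpen_compl
  -- The trace of `W t i` outside `V` is captured by the members of the finite cover based in `P t i`.
  let O : Fin 3 → Set X := fun i => un V V' {y | y ∈ F V V' ∧ y ∈ P t i}
  have hO𝒜 : ∀ i, O i ∈ 𝒜 := fun i =>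
    h𝒜op ![V, V', V, V] (fun j => by fin_cases j <;> assumption) _
      (Or.inl (Or.inr ⟨_, fun y hy => hy.1, rfl⟩))
      (isOpen_biUnion fun y hy => hH.isOpen _ _ hV'o (hyV' y hy.1))
  have hWO : ∀ i, ∀ x ∈ W t i, x ∉ V → x ∈ O i := by
    intro i x hx hxV
    obtain ⟨y, hy, hxy⟩ := Set.mem_iUnion₂.1 (hFc hxV)
    refine Set.mem_iUnion₂.2 ⟨y, ⟨hy, ?_⟩, hxy⟩
    by_contra hyP
    exact Set.disjoint_left.1 (hH.disjoint _ _ _ _ hV'o (hyV' y hy) (hPto i) (htP i) hyP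
      fun h => h (subset_closure (htV' i))) hxy hx
  have hOW : ∀ i j, i ≠ j → ∀ x ∈ O i, x ∉ W t j := by
    intro i j hij x hx hxW
    obtain ⟨y, hy, hxy⟩ := Set.mem_iUnion₂.1 hx
    exact Set.disjoint_left.1 (hH.disjoint _ _ _ _ hV'o (hyV' y hy.1) (hPto j) (htP j)
      (fun h => Set.disjoint_left.1 (hPtd i j hij) hy.2 h)
      fun h => h (subset_closure (htV' j))) hxy hxW
  -- `V` and the sets `O i` are not split by some good triple meeting the exterior of `V`; by closure,
  -- such a triple `s` exists with all `W s i` in `𝒜`.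
  have hex : ∃ s, Q (Fin.cons V O) s := by
    have hns : ¬ Small (closure V)ᶜ := fun h =>
      hsmall z hz hzu _ isClosed_closure.isOpen_compl h k hzV
    have hns' : ∃ s, Good d s ∧ Unsplit 𝒜 s ∧ ∃ i, s i ∈ (closure V)ᶜ := by
      by_contra! h
      exact hns ⟨𝒜, h𝒜, h⟩
    obtain ⟨s, hs, hsu, i, hi⟩ := hns'
    exact ⟨s, hs, fun j hj => hi (subset_closure (hsu V hV j i hj)), fun i => hsu _ (hO𝒜 i)⟩
  obtain ⟨s, ⟨hs, hsV, hsO⟩, hsW⟩ := hop₃ _ hex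
  have hsW𝒜 : ∀ i, W s i ∈ 𝒜 := fun i =>
    h𝒜op (Fin.cons V O) (fun j => by
      refine Fin.cases ?_ (fun j => ?_) j
      · exact hV
      · exact hO𝒜 j) _ (Or.inr (hsW i)) (hWo s hs.1 i)
  have h1 : ∀ i j, t i ∈ W s i → t j ∈ W s j → i = j := by
    intro i j hi hj
    by_contra hij
    exact Set.disjoint_left.1 ((hP s hs.1).2.2 i j hij)
      (hWP s hs.1 i (htu _ (hsW𝒜 i) i j hi)) (hWP s hs.1 j hj)
  have h2 : ∀ i j, s i ∈ W t i → s j ∈ W t j → i = j := by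
    intro i j hi hj
    by_contra hij
    exact hOW i j hij _ (hsO i i j (hWO i _ hi (hsV i))) hj
  have h3 : ∀ i, t i ∈ W s i ∨ s i ∈ W t i := by
    intro i
    by_contra! h
    exact Set.disjoint_left.1 (hH.disjoint _ _ _ _ (hWo t ht.1 i) (htW t ht.1 i) (hWo s hs.1 i)
      (htW s hs.1 i) h.1 h.2) (ht.2 i) (hs.2 i)
  rcases h3 0 with a | a <;> rcases h3 1 with b | b <;> rcases h3 2 with c | c <;>
    first
    | exact absurd (h1 0 1 a b) (by decide)
    | exact absurd (h1 0 2 a c) (by decide)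
    | exact absurd (h1 1 2 b c) (by decide)
    | exact absurd (h2 0 1 a b) (by decide)
    | exact absurd (h2 0 2 a c) (by decide)
    | exact absurd (h2 1 2 b c) (by decide)

/-- A separable monotonically normal compactum has countably many continuous real-valued functions
no three distinct points of which are identified by all of them. -/
theorem exists_seq_continuous_splitting [T2Space X] [CompactSpace X]
    [TopologicalSpace.SeparableSpace X] (hX : MonotonicallyNormal X) :
    ∃ f : ℕ → X → ℝ, (∀ n, Continuous (f n)) ∧
      ∀ t : Fin 3 → X, Function.Injective t → ∃ n i j, f n (t i) ≠ f n (t j) := by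
  obtain ⟨H, hH⟩ := hX
  have := hH.hereditarilyLindelofSpace
  obtain ⟨𝒜, h𝒜c, h𝒜o, h𝒜⟩ := hH.exists_countable_splitting
  choose s hso hsU hUs using fun U : 𝒜 => exists_seq_isOpen_closure_subset (h𝒜o U U.2)
  have hf : ∀ p : 𝒜 × ℕ, ∃ f : C(X, ℝ), Set.EqOn f 0 (p.1 : Set X)ᶜ ∧
      Set.EqOn f 1 (closure (s p.1 p.2)) := fun p => by
    obtain ⟨f, h0, h1, -⟩ := exists_continuous_zero_one_of_isClosed
      (h𝒜o p.1 p.1.2).isClosed_compl (isClosed_closure (s := s p.1 p.2))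
      (Set.disjoint_left.2 fun x hx hx' => hx (hsU p.1 p.2 hx'))
    exact ⟨f, h0, h1⟩
  choose f hf0 hf1 using hf
  have : Countable 𝒜 := h𝒜c.to_subtype
  obtain ⟨g, hg⟩ := exists_surjective_nat (Option (𝒜 × ℕ))
  refine ⟨fun n => ((g n).elim 0 f : C(X, ℝ)), fun n => ContinuousMap.continuous _,
    fun t ht => ?_⟩
  · have h := h𝒜 t ht
    simp only [Unsplit] at h
    push Not at h
    obtain ⟨U, hU, i, j, hi, hj⟩ := h
    obtain ⟨m, hm⟩ := Set.mem_iUnion.1 (hUs ⟨U, hU⟩ hi)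
    obtain ⟨n, hn⟩ := hg (some (⟨U, hU⟩, m))
    refine ⟨n, i, j, ?_⟩
    simp only [hn, Option.elim]
    rw [hf1 (⟨U, hU⟩, m) (subset_closure hm), hf0 (⟨U, hU⟩, m) hj]
    simp

end Topology

/-! ### Closure properties of `H(χ)` -/

section HChi

open Cardinal

variable {χ : Cardinal.{u}}

theorem mem_HSet_iff {a : ZFSet.{u}} : a ∈ HSet χ ↔ a.card < χ ∧ ∀ y ∈ a, y ∈ HSet χ :=
  ZFSet.hereditarily_iff

theorem mem_HSet_of_mem {a b : ZFSet.{u}} (hb : b ∈ HSet χ) (h : a ∈ b) : a ∈ HSet χ :=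
  (mem_HSet_iff.1 hb).2 a h

/-- The membership relation of `H(χ)`. -/
instance instMembershipHSet : Membership (HSet χ) (HSet χ) :=
  ⟨fun b a => (a : ZFSet.{u}) ∈ (b : ZFSet.{u})⟩

theorem HSet.mem_def {a b : HSet χ} : a ∈ b ↔ (a : ZFSet.{u}) ∈ (b : ZFSet.{u}) := Iff.rfl

theorem HSet.ext {a b : HSet χ} (h : ∀ z : HSet χ, z ∈ a ↔ z ∈ b) : a = b := by
  refine Subtype.ext (ZFSet.ext fun z => ⟨fun hz => ?_, fun hz => ?_⟩)
  · exact (h ⟨z, mem_HSet_of_mem a.2 hz⟩).1 hz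
  · exact (h ⟨z, mem_HSet_of_mem b.2 hz⟩).2 hz

theorem sep_mem_HSet {a : ZFSet.{u}} (ha : a ∈ HSet χ) (p : ZFSet.{u} → Prop) :
    ZFSet.sep p a ∈ HSet χ :=
  mem_HSet_iff.2 ⟨(ZFSet.card_mono ZFSet.sep_subset).trans_lt (mem_HSet_iff.1 ha).1,
    fun _ hy => mem_HSet_of_mem ha (ZFSet.mem_sep.1 hy).1⟩

theorem range_mem_HSet {α : Type*} [Small.{u} α] {f : α → ZFSet.{u}} (hf : ∀ i, f i ∈ HSet χ)
    (hα : Cardinal.lift.{u} #α < Cardinal.lift χ) : ZFSet.range f ∈ HSet χ := by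
  refine mem_HSet_iff.2 ⟨?_, fun y hy => ?_⟩
  · exact Cardinal.lift_lt.1 (ZFSet.lift_card_range_le.trans_lt hα)
  · obtain ⟨i, rfl⟩ := ZFSet.mem_range.1 hy
    exact hf i

theorem range_mem_HSet_of_countable (hχ : ℵ₀ < χ) {α : Type} [Countable α] {f : α → ZFSet.{u}}
    (hf : ∀ i, f i ∈ HSet χ) : ZFSet.range f ∈ HSet χ := by
  refine range_mem_HSet hf (lt_of_le_of_lt (b := ℵ₀) ?_ ?_)
  · exact Cardinal.lift_le_aleph0.2 (Cardinal.mk_le_aleph0)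
  · exact Cardinal.aleph0_lt_lift.2 hχ

variable [hχ : Fact (ℵ₀ < χ)]

theorem insert_mem_HSet {a b : ZFSet.{u}} (ha : a ∈ HSet χ) (hb : b ∈ HSet χ) :
    insert a b ∈ HSet χ := by
  refine mem_HSet_iff.2 ⟨ZFSet.card_insert_le.trans_lt ?_, fun y hy => ?_⟩
  · exact Cardinal.add_lt_of_lt hχ.out.le (mem_HSet_iff.1 hb).1
      (Cardinal.one_lt_aleph0.trans hχ.out)
  · rcases ZFSet.mem_insert_iff.1 hy with rfl | h
    · exact ha
    · exact mem_HSet_of_mem hb h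

theorem empty_mem_HSet : (∅ : ZFSet.{u}) ∈ HSet χ :=
  mem_HSet_iff.2 ⟨by simpa using Cardinal.aleph0_pos.trans hχ.out,
    fun y hy => absurd hy (ZFSet.notMem_empty y)⟩

theorem singleton_mem_HSet {a : ZFSet.{u}} (ha : a ∈ HSet χ) : {a} ∈ HSet χ := by
  rw [← insert_empty_eq]
  exact insert_mem_HSet ha empty_mem_HSet

theorem pair_mem_HSet {a b : ZFSet.{u}} (ha : a ∈ HSet χ) (hb : b ∈ HSet χ) :
    ZFSet.pair a b ∈ HSet χ :=
  insert_mem_HSet (singleton_mem_HSet ha)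
    (singleton_mem_HSet (insert_mem_HSet ha (singleton_mem_HSet hb)))

theorem natSet_succ (n : ℕ) : natSet.{u} (n + 1) = insert (natSet n) (natSet n) := by
  simp only [natSet, Nat.cast_add, Nat.cast_one, Ordinal.toZFSet_add_one]

theorem natSet_mem_HSet (n : ℕ) : natSet.{u} n ∈ HSet χ := by
  induction n with
  | zero => simpa [natSet] using empty_mem_HSet
  | succ n ih => rw [natSet_succ]; exact insert_mem_HSet ih ih

/-- The empty set, as an element of `H(χ)`. -/
def HSet.zero : HSet χ := ⟨∅, empty_mem_HSet⟩

/-- The ordinal successor `a ∪ {a}`, as an element of `H(χ)`. -/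
def HSet.succ (a : HSet χ) : HSet χ :=
  ⟨insert (a : ZFSet.{u}) (a : ZFSet.{u}), insert_mem_HSet a.2 a.2⟩

/-- The ordered pair, as an element of `H(χ)`. -/
def HSet.opair (a b : HSet χ) : HSet χ := ⟨ZFSet.pair a b, pair_mem_HSet a.2 b.2⟩

/-- The natural number `n`, as an element of `H(χ)`. -/
def HSet.nat (n : ℕ) : HSet χ := ⟨natSet n, natSet_mem_HSet n⟩

theorem HSet.opair_inj {a b a' b' : HSet χ} :
    HSet.opair a b = HSet.opair a' b' ↔ a = a' ∧ b = b' := by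
  simp [HSet.opair, Subtype.ext_iff, ZFSet.pair_inj]

theorem HSet.nat_zero : (HSet.nat 0 : HSet χ) = HSet.zero :=
  Subtype.ext (by simp [HSet.nat, HSet.zero, natSet])

theorem HSet.nat_succ (n : ℕ) : (HSet.nat (n + 1) : HSet χ) = HSet.succ (HSet.nat n) :=
  Subtype.ext (natSet_succ n)

theorem natSet_injective : Function.Injective natSet.{u} := fun m n h => by
  simpa [natSet] using Ordinal.toZFSet_injective h

theorem HSet.nat_inj {m n : ℕ} : (HSet.nat m : HSet χ) = HSet.nat n ↔ m = n :=
  ⟨fun h => natSet_injective (Subtype.ext_iff.1 h), fun h => h ▸ rfl⟩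

theorem HSet.nat_mem_nat {m n : ℕ} : (HSet.nat m : HSet χ) ∈ (HSet.nat n : HSet χ) ↔ m < n := by
  simp [HSet.mem_def, HSet.nat, natSet, Ordinal.toZFSet_mem_toZFSet_iff]

end HChi

/-! ### Definable relations over `H(χ)` -/

section Definability

open FirstOrder FirstOrder.Language Sum

variable {χ : Cardinal.{u}} {α β : Type}

/-- A relation over `H(χ)`, with arguments indexed by `α`, is definable if it is defined by a
formula of the language of set theory without parameters. -/
def Dfn (P : (α → HSet χ) → Prop) : Prop :=
  ∃ φ : setLang.Formula α, ∀ v, φ.Realize v ↔ P v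

/-- An operation on `H(χ)`, with arguments indexed by `α`, is definable if its graph is. -/
def DfnOp (t : (α → HSet χ) → HSet χ) : Prop :=
  Dfn fun w : α ⊕ Unit → HSet χ => w (inr ()) = t fun a => w (inl a)

namespace Dfn

variable {P Q : (α → HSet χ) → Prop}

theorem comp (hP : Dfn P) (g : α → β) : Dfn fun v : β → HSet χ => P fun a => v (g a) := by
  obtain ⟨φ, hφ⟩ := hP
  exact ⟨φ.relabel g, fun v => by rw [Formula.realize_relabel, hφ]; rfl⟩

theorem mem_var (i j : α) : Dfn fun v : α → HSet χ => v i ∈ v j :=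
  let r : setLang.Relations 2 := SetRel.mem
  ⟨r.formula₂ (Term.var i) (Term.var j), fun _ => Formula.realize_rel₂⟩

theorem eq_var (i j : α) : Dfn fun v : α → HSet χ => v i = v j :=
  ⟨Term.equal (Term.var i) (Term.var j), fun v => by rw [Formula.realize_equal]; rfl⟩

theorem not (hP : Dfn P) : Dfn fun v => ¬ P v := by
  obtain ⟨φ, hφ⟩ := hP
  exact ⟨φ.not, fun v => by rw [Formula.realize_not, hφ]⟩

theorem and (hP : Dfn P) (hQ : Dfn Q) : Dfn fun v => P v ∧ Q v := by
  obtain ⟨φ, hφ⟩ := hP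
  obtain ⟨ψ, hψ⟩ := hQ
  exact ⟨φ ⊓ ψ, fun v => by rw [Formula.realize_inf, hφ, hψ]⟩

theorem or (hP : Dfn P) (hQ : Dfn Q) : Dfn fun v => P v ∨ Q v := by
  obtain ⟨φ, hφ⟩ := hP
  obtain ⟨ψ, hψ⟩ := hQ
  exact ⟨φ ⊔ ψ, fun v => by rw [Formula.realize_sup, hφ, hψ]⟩

theorem imp (hP : Dfn P) (hQ : Dfn Q) : Dfn fun v => P v → Q v := by
  obtain ⟨φ, hφ⟩ := hP
  obtain ⟨ψ, hψ⟩ := hQ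
  exact ⟨φ.imp ψ, fun v => by rw [Formula.realize_imp, hφ, hψ]⟩

theorem iff (hP : Dfn P) (hQ : Dfn Q) : Dfn fun v => P v ↔ Q v := by
  obtain ⟨φ, hφ⟩ := hP
  obtain ⟨ψ, hψ⟩ := hQ
  exact ⟨φ.iff ψ, fun v => by rw [Formula.realize_iff, hφ, hψ]⟩

theorem ex {P : (α → HSet χ) → HSet χ → Prop}
    (hP : Dfn fun w : α ⊕ Unit → HSet χ => P (fun a => w (inl a)) (w (inr ()))) :
    Dfn fun v => ∃ x, P v x := by
  obtain ⟨φ, hφ⟩ := hP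
  refine ⟨φ.iExs Unit, fun v => ?_⟩
  rw [Formula.realize_iExs]
  refine ⟨fun ⟨i, hi⟩ => ⟨i (), (hφ _).1 hi⟩, fun ⟨x, hx⟩ => ⟨fun _ => x, (hφ _).2 hx⟩⟩

theorem all {P : (α → HSet χ) → HSet χ → Prop}
    (hP : Dfn fun w : α ⊕ Unit → HSet χ => P (fun a => w (inl a)) (w (inr ()))) :
    Dfn fun v => ∀ x, P v x := by
  have h := (ex (P := fun v x => ¬ P v x) hP.not).not
  simpa only [not_exists, not_not] using h

theorem subst {P : (α → HSet χ) → HSet χ → Prop} {t : (α → HSet χ) → HSet χ} (ht : DfnOp t)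
    (hP : Dfn fun w : α ⊕ Unit → HSet χ => P (fun a => w (inl a)) (w (inr ()))) :
    Dfn fun v => P v (t v) := by
  have h := ex (P := fun v x => x = t v ∧ P v x) (and ht hP)
  simpa only [exists_eq_left] using h

theorem mem {s t : (α → HSet χ) → HSet χ} (hs : DfnOp s) (ht : DfnOp t) :
    Dfn fun v => s v ∈ t v :=
  subst hs (P := fun v x => x ∈ t v) <|
    subst (P := fun v x => v (inr ()) ∈ x) (ht.comp (Sum.map inl id)) (mem_var _ _)

theorem eq {s t : (α → HSet χ) → HSet χ} (hs : DfnOp s) (ht : DfnOp t) :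
    Dfn fun v => s v = t v :=
  subst hs (P := fun v x => x = t v) ht

end Dfn

namespace DfnOp

theorem var (i : α) : DfnOp fun v : α → HSet χ => v i := Dfn.eq_var _ _

/-- An operation is definable as soon as membership in its values is. -/
theorem of_mem {t : (α → HSet χ) → HSet χ}
    (ht : Dfn fun w : α ⊕ Unit → HSet χ => w (inr ()) ∈ t fun a => w (inl a)) : DfnOp t := by
  have h := Dfn.all (α := α ⊕ Unit)
    (P := fun (w : α ⊕ Unit → HSet χ) z => z ∈ w (inr ()) ↔ z ∈ t fun a => w (inl a))
    ((Dfn.mem_var _ _).iff (ht.comp (Sum.map inl id)))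
  have h' : ∀ w : α ⊕ Unit → HSet χ, (∀ z, z ∈ w (inr ()) ↔ z ∈ t fun a => w (inl a)) ↔
      w (inr ()) = t fun a => w (inl a) := fun w => ⟨HSet.ext, fun h z => by rw [h]⟩
  simp only [h'] at h
  exact h

theorem comp {t : (α → HSet χ) → HSet χ} (ht : DfnOp t) (g : α → β) :
    DfnOp fun v : β → HSet χ => t fun a => v (g a) :=
  Dfn.comp ht (Sum.map g id)

variable [hχ : Fact (Cardinal.aleph0 < χ)]

theorem zero : DfnOp fun _ : α → HSet χ => HSet.zero :=
  of_mem <| by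
    have h : Dfn fun w : α ⊕ Unit → HSet χ => ¬ w (inr ()) = w (inr ()) := (Dfn.eq_var _ _).not
    refine Eq.mp (congrArg Dfn (funext fun w => propext ?_)) h
    simp [HSet.mem_def, HSet.zero]

theorem succ {s : (α → HSet χ) → HSet χ} (hs : DfnOp s) : DfnOp fun v => HSet.succ (s v) :=
  of_mem <| by
    have h := (Dfn.eq (var (χ := χ) (inr ())) (hs.comp (inl : α → α ⊕ Unit))).or
      (Dfn.mem (var (χ := χ) (inr ())) (hs.comp (inl : α → α ⊕ Unit)))
    refine Eq.mp (congrArg Dfn (funext fun w => propext ?_)) h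
    simp [HSet.mem_def, HSet.succ, Subtype.ext_iff]

theorem upair {s t : (α → HSet χ) → HSet χ} (hs : DfnOp s) (ht : DfnOp t) :
    DfnOp fun v => (⟨{(s v : ZFSet.{u}), (t v : ZFSet.{u})},
      insert_mem_HSet (s v).2 (singleton_mem_HSet (t v).2)⟩ : HSet χ) :=
  of_mem <| by
    have h := (Dfn.eq (var (χ := χ) (inr ())) (hs.comp (inl : α → α ⊕ Unit))).or
      (Dfn.eq (var (χ := χ) (inr ())) (ht.comp (inl : α → α ⊕ Unit)))
    refine Eq.mp (congrArg Dfn (funext fun w => propext ?_)) h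
    simp [HSet.mem_def, Subtype.ext_iff]

theorem opair {s t : (α → HSet χ) → HSet χ} (hs : DfnOp s) (ht : DfnOp t) :
    DfnOp fun v => HSet.opair (s v) (t v) := by
  have h := upair (upair hs hs) (upair hs ht)
  refine Eq.mp (congrArg DfnOp (funext fun w => ?_)) h
  simp [HSet.opair, ZFSet.pair]

end DfnOp

/-- The Tarski–Vaught property: an elementary submodel contains a witness for each definable
relation with parameters in it that has a witness in `H(χ)`. -/
theorem exists_mem_of_dfn (M : setLang.ElementarySubstructure (HSet χ))
    {P : (α → HSet χ) → HSet χ → Prop}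
    (hP : Dfn fun w : α ⊕ Unit → HSet χ => P (fun a => w (inl a)) (w (inr ())))
    (v : α → HSet χ) (hv : ∀ i, v i ∈ M) (h : ∃ x, P v x) : ∃ x, x ∈ M ∧ P v x := by
  obtain ⟨φ, hφ⟩ := hP
  obtain ⟨x, hx⟩ := h
  let v' : α → M := fun i => ⟨v i, hv i⟩
  have h1 : (φ.iExs Unit).Realize v := by
    rw [Formula.realize_iExs]
    exact ⟨fun _ => x, (hφ _).2 hx⟩
  have h2 : (φ.iExs Unit).Realize v' := (M.subtype.map_formula (φ.iExs Unit) v').1 h1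
  rw [Formula.realize_iExs] at h2
  obtain ⟨i, hi⟩ := h2
  refine ⟨i (), (i ()).2, ?_⟩
  have h3 := (hφ _).1 ((M.subtype.map_formula φ _).2 hi)
  exact h3

end Definability

/-! ### Arithmetic of natural numbers and rationals inside the submodel -/

section Arithmetic

variable {χ : Cardinal.{u}} [hχ : Fact (Cardinal.aleph0 < χ)]

namespace HSet

/-- The ordered triple `(a, (b, c))`, as an element of `H(χ)`. -/
def triple (a b c : HSet χ) : HSet χ := opair a (opair b c)

/-- A triple of natural numbers, as an element of `H(χ)`. -/
def natTriple (t : ℕ × ℕ × ℕ) : HSet χ := triple (nat t.1) (nat t.2.1) (nat t.2.2)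

/-- The set of all natural numbers, as an element of `H(χ)`. -/
def omega : HSet χ :=
  ⟨ZFSet.range natSet, range_mem_HSet_of_countable hχ.out natSet_mem_HSet⟩

/-- The set of all triples of natural numbers in `p`, as an element of `H(χ)`. -/
def tripleSet (p : ℕ × ℕ × ℕ → Prop) : HSet χ :=
  ⟨ZFSet.range fun t : {t // p t} => (natTriple (t : ℕ × ℕ × ℕ) : HSet χ),
    range_mem_HSet_of_countable hχ.out fun _ => (natTriple _).2⟩

theorem triple_inj {a b c a' b' c' : HSet χ} :
    triple a b c = triple a' b' c' ↔ a = a' ∧ b = b' ∧ c = c' := by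
  simp [triple, opair_inj]

theorem natTriple_inj {s t : ℕ × ℕ × ℕ} : (natTriple s : HSet χ) = natTriple t ↔ s = t := by
  simp [natTriple, triple_inj, nat_inj, Prod.ext_iff]

theorem mem_omega {z : HSet χ} : z ∈ (omega : HSet χ) ↔ ∃ n, z = nat n := by
  simp [mem_def, omega, nat, Subtype.ext_iff, eq_comm]

theorem mem_tripleSet {p : ℕ × ℕ × ℕ → Prop} {z : HSet χ} :
    z ∈ (tripleSet p : HSet χ) ↔ ∃ t, p t ∧ z = natTriple t := by
  simp only [mem_def, tripleSet, ZFSet.mem_range, Subtype.exists, Subtype.ext_iff, exists_prop,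
    eq_comm]

theorem natTriple_mem_tripleSet {p : ℕ × ℕ × ℕ → Prop} {t : ℕ × ℕ × ℕ} :
    natTriple t ∈ (tripleSet p : HSet χ) ↔ p t := by
  simp [mem_tripleSet, natTriple_inj]

theorem zero_mem_omega : zero ∈ (omega : HSet χ) := mem_omega.2 ⟨0, nat_zero.symm⟩

end HSet

open HSet

theorem DfnOp.triple {α : Type} {s t r : (α → HSet χ) → HSet χ} (hs : DfnOp s) (ht : DfnOp t)
    (hr : DfnOp r) : DfnOp fun v => triple (s v) (t v) (r v) :=
  opair hs (opair ht hr)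

/-- `N` is the least inductive set. -/
def IsOmega (N : HSet χ) : Prop :=
  (zero ∈ N ∧ ∀ n, n ∈ N → succ n ∈ N) ∧
    ∀ S : HSet χ, (zero ∈ S ∧ ∀ n, n ∈ S → succ n ∈ S) → ∀ n, n ∈ N → n ∈ S

/-- `A` restricts to the graph of addition on the set `N` of natural numbers. -/
def IsAdd (N A : HSet χ) : Prop :=
  ∀ a, a ∈ N → ∀ c, c ∈ N → (triple a zero c ∈ A ↔ c = a) ∧
    ∀ b, b ∈ N → (triple a (succ b) c ∈ A ↔ ∃ c', c' ∈ N ∧ c = succ c' ∧ triple a b c' ∈ A)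

/-- `B` restricts to the graph of multiplication on the set `N` of natural numbers, where `A` is
addition. -/
def IsMul (N A B : HSet χ) : Prop :=
  ∀ a, a ∈ N → ∀ c, c ∈ N → (triple a zero c ∈ B ↔ c = zero) ∧
    ∀ b, b ∈ N → (triple a (succ b) c ∈ B ↔ ∃ c', c' ∈ N ∧ triple a b c' ∈ B ∧ triple c' a c ∈ A)

/-- `T` is the set of all triples of elements of `N`. -/
def IsTriples (N T : HSet χ) : Prop :=
  ∀ z, z ∈ T ↔ ∃ a, a ∈ N ∧ ∃ b, b ∈ N ∧ ∃ c, c ∈ N ∧ z = triple a b c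

/-- The inequality `x * succ y' + z' * succ y < x' * succ y + z * succ y'`, that is,
`(x - z) / (y + 1) < (x' - z') / (y' + 1)`, in terms of the addition `A` and the multiplication `B`
on `N`. -/
def FracLt (N A B x z y x' z' y' : HSet χ) : Prop :=
  ∃ p, p ∈ N ∧ ∃ q, q ∈ N ∧ ∃ p', p' ∈ N ∧ ∃ q', q' ∈ N ∧ ∃ r, r ∈ N ∧ ∃ r', r' ∈ N ∧
    triple x (succ y') p ∈ B ∧ triple z' (succ y) q ∈ B ∧ triple x' (succ y) p' ∈ B ∧
    triple z (succ y') q' ∈ B ∧ triple p q r ∈ A ∧ triple p' q' r' ∈ A ∧ r ∈ r'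

/-- `L` is the strict order of the rationals, as a relation between triples of elements of `N`. -/
def IsRatLt (N A B L : HSet χ) : Prop :=
  ∀ w, w ∈ L ↔ ∃ x, x ∈ N ∧ ∃ z, z ∈ N ∧ ∃ y, y ∈ N ∧ ∃ x', x' ∈ N ∧ ∃ z', z' ∈ N ∧ ∃ y', y' ∈ N ∧
    w = opair (triple x z y) (triple x' z' y') ∧ FracLt N A B x z y x' z' y'

section Dfn

variable {α : Type}

theorem dfn_isOmega (i : α) : Dfn fun v : α → HSet χ => IsOmega (v i) := by
  unfold IsOmega
  repeat' with_reducible first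
    | apply Dfn.and | apply Dfn.imp | apply Dfn.all | apply Dfn.mem | apply DfnOp.succ
    | exact DfnOp.zero | exact DfnOp.var _

theorem dfn_isAdd (i j : α) : Dfn fun v : α → HSet χ => IsAdd (v i) (v j) := by
  unfold IsAdd
  repeat' with_reducible first
    | apply Dfn.and | apply Dfn.iff | apply Dfn.imp | apply Dfn.all | apply Dfn.ex | apply Dfn.mem
    | apply Dfn.eq | apply DfnOp.triple | apply DfnOp.succ | exact DfnOp.zero | exact DfnOp.var _

theorem dfn_isMul (i j k : α) : Dfn fun v : α → HSet χ => IsMul (v i) (v j) (v k) := by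
  unfold IsMul
  repeat' with_reducible first
    | apply Dfn.and | apply Dfn.iff | apply Dfn.imp | apply Dfn.all | apply Dfn.ex | apply Dfn.mem
    | apply Dfn.eq | apply DfnOp.triple | apply DfnOp.succ | exact DfnOp.zero | exact DfnOp.var _

theorem dfn_isTriples (i j : α) : Dfn fun v : α → HSet χ => IsTriples (v i) (v j) := by
  unfold IsTriples
  repeat' with_reducible first
    | apply Dfn.and | apply Dfn.iff | apply Dfn.all | apply Dfn.ex | apply Dfn.mem
    | apply Dfn.eq | apply DfnOp.triple | exact DfnOp.var _

theorem dfn_isRatLt (i j k l : α) :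
    Dfn fun v : α → HSet χ => IsRatLt (v i) (v j) (v k) (v l) := by
  unfold IsRatLt FracLt
  repeat' with_reducible first
    | apply Dfn.and | apply Dfn.iff | apply Dfn.all | apply Dfn.ex | apply Dfn.mem
    | apply Dfn.eq | apply DfnOp.triple | apply DfnOp.opair | apply DfnOp.succ | exact DfnOp.var _

end Dfn

theorem isOmega_iff {N : HSet χ} : IsOmega N ↔ N = omega := by
  have hsucc : ∀ n : HSet χ, n ∈ (omega : HSet χ) → succ n ∈ (omega : HSet χ) := by
    intro n hn
    obtain ⟨k, rfl⟩ := mem_omega.1 hn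
    exact mem_omega.2 ⟨k + 1, (nat_succ k).symm⟩
  have hnat : ∀ S : HSet χ, (zero ∈ S ∧ ∀ n, n ∈ S → succ n ∈ S) → ∀ n, n ∈ omega → n ∈ S := by
    intro S hS n hn
    obtain ⟨k, rfl⟩ := mem_omega.1 hn
    induction k with
    | zero => rw [nat_zero]; exact hS.1
    | succ k ih => rw [nat_succ]; exact hS.2 _ (ih (mem_omega.2 ⟨k, rfl⟩))
  constructor
  · intro h
    exact HSet.ext fun z => ⟨h.2 _ ⟨zero_mem_omega, hsucc⟩ z, hnat _ h.1 z⟩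
  · rintro rfl
    exact ⟨⟨zero_mem_omega, hsucc⟩, hnat⟩

theorem IsAdd.triple_mem {A : HSet χ} (hA : IsAdd omega A) (a b c : ℕ) :
    triple (nat a) (nat b) (nat c) ∈ A ↔ a + b = c := by
  induction b generalizing c with
  | zero =>
    rw [nat_zero, (hA _ (mem_omega.2 ⟨a, rfl⟩) _ (mem_omega.2 ⟨c, rfl⟩)).1, nat_inj]
    exact eq_comm
  | succ b ih =>
    rw [nat_succ, (hA _ (mem_omega.2 ⟨a, rfl⟩) _ (mem_omega.2 ⟨c, rfl⟩)).2 _ (mem_omega.2 ⟨b, rfl⟩)]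
    constructor
    · rintro ⟨c', hc', hc, h⟩
      obtain ⟨k, rfl⟩ := mem_omega.1 hc'
      rw [← nat_succ, nat_inj] at hc
      have := (ih k).1 h
      omega
    · rintro rfl
      exact ⟨nat (a + b), mem_omega.2 ⟨_, rfl⟩, by rw [← nat_succ]; rfl, (ih _).2 rfl⟩

theorem IsMul.triple_mem {A B : HSet χ} (hA : IsAdd omega A) (hB : IsMul omega A B) (a b c : ℕ) :
    triple (nat a) (nat b) (nat c) ∈ B ↔ a * b = c := by
  induction b generalizing c with
  | zero =>
    rw [nat_zero, (hB _ (mem_omega.2 ⟨a, rfl⟩) _ (mem_omega.2 ⟨c, rfl⟩)).1, ← nat_zero, nat_inj]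
    simp [eq_comm]
  | succ b ih =>
    rw [nat_succ, (hB _ (mem_omega.2 ⟨a, rfl⟩) _ (mem_omega.2 ⟨c, rfl⟩)).2 _ (mem_omega.2 ⟨b, rfl⟩)]
    constructor
    · rintro ⟨c', hc', h, hc⟩
      obtain ⟨k, rfl⟩ := mem_omega.1 hc'
      rw [hA.triple_mem] at hc
      rw [Nat.mul_succ, (ih k).1 h, hc]
    · rintro rfl
      exact ⟨nat (a * b), mem_omega.2 ⟨_, rfl⟩, (ih _).2 rfl, (hA.triple_mem _ _ _).2 rfl⟩

theorem exists_isAdd : ∃ A : HSet χ, IsAdd omega A := by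
  refine ⟨tripleSet fun t => t.1 + t.2.1 = t.2.2, fun a ha c hc => ?_⟩
  have key : ∀ a b c : ℕ, triple (nat a) (nat b) (nat c) ∈
      (tripleSet (fun t => t.1 + t.2.1 = t.2.2) : HSet χ) ↔ a + b = c := fun a b c =>
    natTriple_mem_tripleSet (t := (a, b, c))
  obtain ⟨a, rfl⟩ := mem_omega.1 ha
  obtain ⟨c, rfl⟩ := mem_omega.1 hc
  refine ⟨by rw [← nat_zero, key, nat_inj, add_zero, eq_comm], fun b hb => ?_⟩
  obtain ⟨b, rfl⟩ := mem_omega.1 hb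
  rw [← nat_succ, key]
  constructor
  · rintro rfl
    exact ⟨nat (a + b), mem_omega.2 ⟨_, rfl⟩, nat_succ _, (key _ _ _).2 rfl⟩
  · rintro ⟨c', hc', hc, h⟩
    obtain ⟨k, rfl⟩ := mem_omega.1 hc'
    rw [← nat_succ, nat_inj] at hc
    rw [key] at h
    omega

theorem exists_isMul {A : HSet χ} (hA : IsAdd omega A) : ∃ B : HSet χ, IsMul omega A B := by
  refine ⟨tripleSet fun t => t.1 * t.2.1 = t.2.2, fun a ha c hc => ?_⟩
  have key : ∀ a b c : ℕ, triple (nat a) (nat b) (nat c) ∈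
      (tripleSet (fun t => t.1 * t.2.1 = t.2.2) : HSet χ) ↔ a * b = c := fun a b c =>
    natTriple_mem_tripleSet (t := (a, b, c))
  obtain ⟨a, rfl⟩ := mem_omega.1 ha
  obtain ⟨c, rfl⟩ := mem_omega.1 hc
  refine ⟨by rw [← nat_zero, key, nat_inj, mul_zero, eq_comm], fun b hb => ?_⟩
  obtain ⟨b, rfl⟩ := mem_omega.1 hb
  rw [← nat_succ, key]
  constructor
  · rintro rfl
    exact ⟨nat (a * b), mem_omega.2 ⟨_, rfl⟩, (key _ _ _).2 rfl, (hA.triple_mem _ _ _).2 rfl⟩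
  · rintro ⟨c', hc', hc, h⟩
    obtain ⟨k, rfl⟩ := mem_omega.1 hc'
    rw [hA.triple_mem] at h
    rw [key] at hc
    rw [Nat.mul_succ, hc, h]

/-- The rational number presented by a triple of natural numbers. -/
def frac (t : ℕ × ℕ × ℕ) : ℝ := ((t.1 : ℝ) - (t.2.1 : ℝ)) / ((t.2.2 : ℝ) + 1)

theorem frac_lt_frac {s t : ℕ × ℕ × ℕ} :
    frac s < frac t ↔
      s.1 * (t.2.2 + 1) + t.2.1 * (s.2.2 + 1) < t.1 * (s.2.2 + 1) + s.2.1 * (t.2.2 + 1) := by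
  have h1 : (0 : ℝ) < s.2.2 + 1 := by positivity
  have h2 : (0 : ℝ) < t.2.2 + 1 := by positivity
  rw [frac, frac, div_lt_div_iff₀ h1 h2, ← Nat.cast_lt (α := ℝ)]
  push_cast
  constructor <;> intro h <;> linarith

theorem exists_frac_eq (r : ℚ) : ∃ t, frac t = r := by
  refine ⟨(r.num.toNat, (-r.num).toNat, r.den - 1), ?_⟩
  have h1 : ((r.num.toNat : ℤ) : ℝ) - (((-r.num).toNat : ℤ) : ℝ) = r.num := by
    rw [← Int.cast_sub, Int.toNat_sub_toNat_neg]
  have h2 : ((r.den - 1 : ℕ) : ℝ) + 1 = r.den := by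
    have := r.den_pos
    rw [Nat.cast_sub (by omega)]; simp
  simp only [frac]
  rw [h2]
  simp only [Int.cast_natCast] at h1
  rw [h1, Rat.cast_def]

theorem exists_frac_btwn {a b : ℝ} (h : a < b) : ∃ t, a < frac t ∧ frac t < b := by
  obtain ⟨r, h1, h2⟩ := exists_rat_btwn h
  obtain ⟨t, ht⟩ := exists_frac_eq r
  exact ⟨t, by rwa [ht], by rwa [ht]⟩

theorem fracLt_iff {A B : HSet χ} (hA : IsAdd omega A) (hB : IsMul omega A B) (a b c a' b' c' : ℕ) :
    FracLt omega A B (nat a) (nat b) (nat c) (nat a') (nat b') (nat c') ↔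
      frac (a, b, c) < frac (a', b', c') := by
  rw [frac_lt_frac]
  have hm : ∀ n, nat n ∈ (omega : HSet χ) := fun n => mem_omega.2 ⟨n, rfl⟩
  constructor
  · rintro ⟨p, hp, q, hq, p', hp', q', hq', r, hr, r', hr', h1, h2, h3, h4, h5, h6, h7⟩
    obtain ⟨p, rfl⟩ := mem_omega.1 hp
    obtain ⟨q, rfl⟩ := mem_omega.1 hq
    obtain ⟨p', rfl⟩ := mem_omega.1 hp'
    obtain ⟨q', rfl⟩ := mem_omega.1 hq'
    obtain ⟨r, rfl⟩ := mem_omega.1 hr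
    obtain ⟨r', rfl⟩ := mem_omega.1 hr'
    rw [← nat_succ, hB.triple_mem hA] at h1 h2 h3 h4
    rw [hA.triple_mem] at h5 h6
    rw [nat_mem_nat] at h7
    subst h1 h2 h3 h4 h5 h6
    exact h7
  · intro h
    refine ⟨_, hm (a * (c' + 1)), _, hm (b' * (c + 1)), _, hm (a' * (c + 1)), _, hm (b * (c' + 1)),
      _, hm (a * (c' + 1) + b' * (c + 1)), _, hm (a' * (c + 1) + b * (c' + 1)), ?_⟩
    simp only [← nat_succ, hB.triple_mem hA, hA.triple_mem, nat_mem_nat, true_and]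
    exact h

theorem exists_isRatLt {A B : HSet χ} (hA : IsAdd omega A) (hB : IsMul omega A B) :
    ∃ L : HSet χ, IsRatLt omega A B L := by
  let f : {p : (ℕ × ℕ × ℕ) × ℕ × ℕ × ℕ // frac p.1 < frac p.2} → HSet χ := fun p =>
    opair (natTriple p.1.1) (natTriple p.1.2)
  refine ⟨⟨ZFSet.range fun p => (f p : ZFSet.{u}),
    range_mem_HSet_of_countable hχ.out fun p => (f p).2⟩, fun w => ?_⟩
  simp only [HSet.mem_def, ZFSet.mem_range]
  constructor
  · rintro ⟨⟨⟨⟨a, b, c⟩, ⟨a', b', c'⟩⟩, h⟩, hw⟩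
    exact ⟨nat a, mem_omega.2 ⟨_, rfl⟩, nat b, mem_omega.2 ⟨_, rfl⟩, nat c, mem_omega.2 ⟨_, rfl⟩,
      nat a', mem_omega.2 ⟨_, rfl⟩, nat b', mem_omega.2 ⟨_, rfl⟩, nat c', mem_omega.2 ⟨_, rfl⟩,
      Subtype.ext hw.symm, (fracLt_iff hA hB _ _ _ _ _ _).2 h⟩
  · rintro ⟨x, hx, y, hy, z, hz, x', hx', y', hy', z', hz', rfl, h⟩
    obtain ⟨a, rfl⟩ := mem_omega.1 hx
    obtain ⟨b, rfl⟩ := mem_omega.1 hy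
    obtain ⟨c, rfl⟩ := mem_omega.1 hz
    obtain ⟨a', rfl⟩ := mem_omega.1 hx'
    obtain ⟨b', rfl⟩ := mem_omega.1 hy'
    obtain ⟨c', rfl⟩ := mem_omega.1 hz'
    exact ⟨⟨((a, b, c), (a', b', c')), (fracLt_iff hA hB _ _ _ _ _ _).1 h⟩, rfl⟩

theorem IsRatLt.opair_mem {A B L : HSet χ} (hA : IsAdd omega A) (hB : IsMul omega A B)
    (hL : IsRatLt omega A B L) (s t : ℕ × ℕ × ℕ) :
    opair (natTriple s) (natTriple t) ∈ L ↔ frac s < frac t := by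
  rw [hL]
  constructor
  · rintro ⟨x, hx, y, hy, z, hz, x', hx', y', hy', z', hz', he, h⟩
    simp only [natTriple, opair_inj, triple_inj] at he
    obtain ⟨⟨rfl, rfl, rfl⟩, rfl, rfl, rfl⟩ := he
    exact (fracLt_iff hA hB _ _ _ _ _ _).1 h
  · intro h
    exact ⟨_, mem_omega.2 ⟨_, rfl⟩, _, mem_omega.2 ⟨_, rfl⟩, _, mem_omega.2 ⟨_, rfl⟩,
      _, mem_omega.2 ⟨_, rfl⟩, _, mem_omega.2 ⟨_, rfl⟩, _, mem_omega.2 ⟨_, rfl⟩,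
      rfl, (fracLt_iff hA hB _ _ _ _ _ _).2 h⟩

theorem isTriples_iff {T : HSet χ} : IsTriples omega T ↔ T = tripleSet fun _ => True := by
  have key : ∀ z : HSet χ, z ∈ (tripleSet fun _ => True : HSet χ) ↔
      ∃ a, a ∈ (omega : HSet χ) ∧ ∃ b, b ∈ (omega : HSet χ) ∧ ∃ c, c ∈ (omega : HSet χ) ∧
        z = triple a b c := fun z => by
    rw [mem_tripleSet]
    constructor
    · rintro ⟨t, -, rfl⟩
      exact ⟨_, mem_omega.2 ⟨_, rfl⟩, _, mem_omega.2 ⟨_, rfl⟩, _, mem_omega.2 ⟨_, rfl⟩, rfl⟩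
    · rintro ⟨a, ha, b, hb, c, hc, rfl⟩
      obtain ⟨a, rfl⟩ := mem_omega.1 ha
      obtain ⟨b, rfl⟩ := mem_omega.1 hb
      obtain ⟨c, rfl⟩ := mem_omega.1 hc
      exact ⟨(a, b, c), trivial, rfl⟩
  constructor
  · exact fun h => HSet.ext fun z => (h z).trans (key z).symm
  · rintro rfl
    exact key

variable (M : setLang.ElementarySubstructure (HSet χ))

theorem omega_mem : (omega : HSet χ) ∈ M := by
  obtain ⟨N, hN, h⟩ := exists_mem_of_dfn M (α := Fin 0) (P := fun _ N => IsOmega N)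
    (dfn_isOmega _) Fin.elim0 (fun i => i.elim0) ⟨omega, isOmega_iff.2 rfl⟩
  rwa [isOmega_iff.1 h] at hN

theorem nat_mem (n : ℕ) : (nat n : HSet χ) ∈ M := by
  induction n with
  | zero =>
    obtain ⟨e, he, h⟩ := exists_mem_of_dfn M (α := Fin 0) (P := fun _ e => e = zero)
      (Dfn.eq (DfnOp.var _) DfnOp.zero) Fin.elim0 (fun i => i.elim0) ⟨zero, rfl⟩
    rw [nat_zero, ← h]; exact he
  | succ n ih =>
    obtain ⟨e, he, h⟩ := exists_mem_of_dfn M (α := Fin 1) (P := fun v e => e = succ (v 0))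
      (Dfn.eq (DfnOp.var _) (DfnOp.succ (DfnOp.var _))) ![nat n] (by simpa using ih) ⟨_, rfl⟩
    rw [nat_succ]; rw [h] at he; exact he

theorem tripleSet_mem : (tripleSet fun _ => True : HSet χ) ∈ M := by
  obtain ⟨T, hT, h⟩ := exists_mem_of_dfn M (α := Fin 1) (P := fun v T => IsTriples (v 0) T)
    (dfn_isTriples _ _) ![omega] (by simpa using omega_mem M) ⟨_, isTriples_iff.2 rfl⟩
  rwa [isTriples_iff.1 h] at hT

theorem exists_ratLt_mem :
    ∃ L ∈ M, ∀ s t, opair (natTriple s) (natTriple t) ∈ L ↔ frac s < frac t := by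
  obtain ⟨A, hAM, hA⟩ := exists_mem_of_dfn M (α := Fin 1) (P := fun v A => IsAdd (v 0) A)
    (dfn_isAdd _ _) ![omega] (by simpa using omega_mem M) exists_isAdd
  obtain ⟨B, hBM, hB⟩ := exists_mem_of_dfn M (α := Fin 2) (P := fun v B => IsMul (v 0) (v 1) B)
    (dfn_isMul _ _ _) ![omega, A] (by simpa using ⟨omega_mem M, hAM⟩) (exists_isMul hA)
  obtain ⟨L, hLM, hL⟩ := exists_mem_of_dfn M (α := Fin 3)
    (P := fun v L => IsRatLt (v 0) (v 1) (v 2) L)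
    (dfn_isRatLt _ _ _ _) ![omega, A, B] (by simpa [Fin.forall_fin_succ] using
      ⟨omega_mem M, hAM, hBM⟩) (exists_isRatLt hA hB)
  exact ⟨L, hLM, IsRatLt.opair_mem hA hB hL⟩

end Arithmetic

/-! ### Sequences of continuous functions inside the submodel -/

section Points

variable {χ : Cardinal.{u}} {X : ZFSet.{u}} (hX : X ∈ HSet χ)

/-- A point of `X`, as an element of `H(χ)`. -/
def ptH (x : X) : HSet χ := ⟨x, mem_HSet_of_mem hX x.2⟩

theorem ptH_mem (x : X) : ptH hX x ∈ (⟨X, hX⟩ : HSet χ) := x.2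

theorem exists_eq_ptH {z : HSet χ} (hz : z ∈ (⟨X, hX⟩ : HSet χ)) : ∃ x, z = ptH hX x :=
  ⟨⟨z, hz⟩, rfl⟩

theorem ptH_inj {x y : X} : ptH hX x = ptH hX y ↔ x = y := by
  rw [ptH, ptH, Subtype.mk.injEq, SetLike.coe_eq_coe]

theorem mem_topologySet [TopologicalSpace X] {U : ZFSet.{u}} :
    U ∈ topologySet X ↔ U ⊆ X ∧ IsOpen {x : X | (x : ZFSet.{u}) ∈ U} := by
  rw [topologySet, ZFSet.mem_sep, ZFSet.mem_powerset]

theorem exists_mem_topologySet [TopologicalSpace X] (hτ : topologySet X ∈ HSet χ) {V : Set X}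
    (hV : IsOpen V) :
    ∃ U : HSet χ, U ∈ (⟨topologySet X, hτ⟩ : HSet χ) ∧ ∀ x : X, ptH hX x ∈ U ↔ x ∈ V := by
  let U : ZFSet.{u} := ZFSet.sep (fun z => ∃ h : z ∈ X, (⟨z, h⟩ : X) ∈ V) X
  have hU : ∀ x : X, (x : ZFSet.{u}) ∈ U ↔ x ∈ V := fun x => by
    simp [U, ZFSet.mem_sep]
  have hUX : U ⊆ X := ZFSet.sep_subset
  refine ⟨⟨U, sep_mem_HSet hX _⟩, mem_topologySet.2 ⟨hUX, ?_⟩, hU⟩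
  have hUV : {x : X | (x : ZFSet.{u}) ∈ U} = V := Set.ext hU
  change IsOpen {x : X | (x : ZFSet.{u}) ∈ U}
  rwa [hUV]

theorem isOpen_of_mem_topologySet [TopologicalSpace X] (hτ : topologySet X ∈ HSet χ) {U : HSet χ}
    (hU : U ∈ (⟨topologySet X, hτ⟩ : HSet χ)) : IsOpen {x : X | ptH hX x ∈ U} :=
  (mem_topologySet.1 hU).2

end Points

section Sequences

open HSet

variable {χ : Cardinal.{u}} [hχ : Fact (Cardinal.aleph0 < χ)]

/-- The set `R` relates the index `n`, the triple `t` and the point `x`. -/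
def Rel (R n t x : HSet χ) : Prop := opair n (opair t x) ∈ R

/-- `R` encodes a sequence, indexed by `N`, of continuous real-valued functions on the space `X`
with topology `τ`: that `R` relates `n`, `t` and `x` means that the rational presented by the triple
`t ∈ T` is below the value of the `n`-th function at `x`. Here `L` is the order of the rationals. The
first part says that Dedekind cuts arise in this way, the second one that the preimages of rays
are open. -/
def IsFunSeq (X τ N T L R : HSet χ) : Prop :=
  (∀ n, n ∈ N → ∀ x, x ∈ X → (∃ t, t ∈ T ∧ Rel R n t x) ∧ (∃ t, t ∈ T ∧ ¬ Rel R n t x) ∧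
    ∀ t, t ∈ T → (Rel R n t x ↔ ∃ s, s ∈ T ∧ opair t s ∈ L ∧ Rel R n s x)) ∧
  ∀ n, n ∈ N → ∀ t, t ∈ T → (∃ U, U ∈ τ ∧ ∀ x, x ∈ X → (x ∈ U ↔ Rel R n t x)) ∧
    ∃ U, U ∈ τ ∧ ∀ x, x ∈ X → (x ∈ U ↔ ∃ s, s ∈ T ∧ opair s t ∈ L ∧ ¬ Rel R n s x)

/-- No three distinct points of `X` are identified by all functions encoded by `R`. -/
def SplitsTriples (X N T R : HSet χ) : Prop :=
  ∀ x, x ∈ X → ∀ y, y ∈ X → ∀ z, z ∈ X → ¬ x = y → ¬ y = z → ¬ x = z →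
    ∃ n, n ∈ N ∧ ∃ t, t ∈ T ∧ (¬ (Rel R n t x ↔ Rel R n t y) ∨ ¬ (Rel R n t y ↔ Rel R n t z))

/-- `f` is the `n`-th function encoded by `R`. -/
def IsEntry (X T R n f : HSet χ) : Prop :=
  ∀ p, p ∈ f ↔ ∃ x, x ∈ X ∧ ∃ r, p = opair x r ∧ ∀ t, t ∈ r ↔ t ∈ T ∧ Rel R n t x

section Dfn

variable {α : Type}

theorem dfn_isFunSeq (i j k l m n : α) :
    Dfn fun v : α → HSet χ => IsFunSeq (v i) (v j) (v k) (v l) (v m) (v n) := by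
  unfold IsFunSeq Rel
  repeat' with_reducible first
    | apply Dfn.and | apply Dfn.iff | apply Dfn.not | apply Dfn.imp | apply Dfn.all | apply Dfn.ex
    | apply Dfn.mem | apply DfnOp.opair | exact DfnOp.var _

theorem dfn_splitsTriples (i j k l : α) :
    Dfn fun v : α → HSet χ => SplitsTriples (v i) (v j) (v k) (v l) := by
  unfold SplitsTriples Rel
  repeat' with_reducible first
    | apply Dfn.and | apply Dfn.or | apply Dfn.iff | apply Dfn.not | apply Dfn.imp | apply Dfn.all
    | apply Dfn.ex | apply Dfn.mem | apply Dfn.eq | apply DfnOp.opair | exact DfnOp.var _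

theorem dfn_isEntry (i j k l m : α) :
    Dfn fun v : α → HSet χ => IsEntry (v i) (v j) (v k) (v l) (v m) := by
  unfold IsEntry Rel
  repeat' with_reducible first
    | apply Dfn.and | apply Dfn.iff | apply Dfn.all | apply Dfn.ex | apply Dfn.mem
    | apply Dfn.eq | apply DfnOp.opair | exact DfnOp.var _

end Dfn

/-- A Dedekind cut in the rationals, presented by triples of natural numbers, is the cut of a real
number. -/
theorem exists_real_of_cut {S : ℕ × ℕ × ℕ → Prop} (h1 : ∃ t, S t) (h2 : ∃ t, ¬ S t)
    (h3 : ∀ t, S t ↔ ∃ s, frac t < frac s ∧ S s) : ∃ r : ℝ, ∀ t, S t ↔ frac t < r := by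
  obtain ⟨b, hb⟩ := h2
  have hne : (frac '' {t | S t}).Nonempty := Set.Nonempty.image _ h1
  have hbdd : BddAbove (frac '' {t | S t}) := by
    refine ⟨frac b, ?_⟩
    rintro _ ⟨s, hs, rfl⟩
    by_contra! h
    exact hb ((h3 b).2 ⟨s, h, hs⟩)
  refine ⟨sSup (frac '' {t | S t}), fun t => ⟨fun ht => ?_, fun ht => ?_⟩⟩
  · obtain ⟨s, hts, hs⟩ := (h3 t).1 ht
    exact hts.trans_le (le_csSup hbdd ⟨s, hs, rfl⟩)
  · obtain ⟨_, ⟨s, hs, rfl⟩, hts⟩ := exists_lt_of_lt_csSup hne ht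
    exact (h3 t).2 ⟨s, hts, hs⟩

variable {X : ZFSet.{u}} (hX : X ∈ HSet χ)

theorem realSet_eq (r : ℝ) : realSet r = (tripleSet (fun t => frac t < r) : HSet χ).1 := rfl

/-- The set encoding the sequence `f` in the sense of `IsFunSeq`. -/
def seqSet (f : ℕ → X → ℝ) : HSet χ :=
  ⟨ZFSet.range fun p : {p : ℕ × (ℕ × ℕ × ℕ) × X // frac p.2.1 < f p.1 p.2.2} =>
      (opair (nat p.1.1) (opair (natTriple p.1.2.1) (ptH hX p.1.2.2)) : HSet χ).1, by
    refine range_mem_HSet (fun p => Subtype.prop _) ?_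
    refine (Cardinal.lift_le.2 (Cardinal.mk_subtype_le _)).trans_lt ?_
    have h1 : Cardinal.mk X < Cardinal.lift.{u + 1} χ := by
      rw [ZFSet.cardinalMk_coe_sort]
      exact Cardinal.lift_lt.2 (mem_HSet_iff.1 hX).1
    have h0 : Cardinal.aleph0 < Cardinal.lift.{u + 1} χ := Cardinal.aleph0_lt_lift.2 hχ.out
    simp only [Cardinal.mk_prod, Cardinal.lift_id, Cardinal.mk_nat, Cardinal.lift_aleph0,
      Cardinal.aleph0_mul_aleph0, Cardinal.lift_uzero, Cardinal.lift_mul]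
    rw [Cardinal.lift_id'.{u, u + 1}]
    exact Cardinal.mul_lt_of_lt h0.le h0 (Cardinal.mul_lt_of_lt h0.le h0 h1)⟩

theorem rel_seqSet {f : ℕ → X → ℝ} {n : ℕ} {t : ℕ × ℕ × ℕ} {x : X} :
    Rel (seqSet hX f) (nat n) (natTriple t) (ptH hX x) ↔ frac t < f n x := by
  simp only [Rel, HSet.mem_def, seqSet, ZFSet.mem_range]
  constructor
  · rintro ⟨⟨⟨m, s, y⟩, h⟩, he⟩
    have he' := Subtype.ext he
    simp only [opair_inj, nat_inj, natTriple_inj, ptH_inj] at he'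
    obtain ⟨rfl, rfl, rfl⟩ := he'
    exact h
  · exact fun h => ⟨⟨(n, t, x), h⟩, rfl⟩

theorem natTriple_mem (t : ℕ × ℕ × ℕ) : natTriple t ∈ (tripleSet fun _ => True : HSet χ) :=
  natTriple_mem_tripleSet.2 trivial

theorem nat_mem_omega (n : ℕ) : nat n ∈ (omega : HSet χ) := mem_omega.2 ⟨n, rfl⟩

theorem exists_mem_triples {p : HSet χ → Prop} :
    (∃ t, t ∈ (tripleSet fun _ => True : HSet χ) ∧ p t) ↔ ∃ t, p (natTriple t) := by
  simp only [mem_tripleSet, true_and]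
  exact ⟨fun ⟨_, ⟨t, h⟩, hp⟩ => ⟨t, h ▸ hp⟩, fun ⟨t, ht⟩ => ⟨_, ⟨t, rfl⟩, ht⟩⟩

theorem funSet_mem_HSet {X : ZFSet.{u}} (hX : X ∈ HSet χ) (g : X → ℝ) : funSet g ∈ HSet χ := by
  refine range_mem_HSet (fun x => ?_) ?_
  · rw [realSet_eq (χ := χ)]
    exact pair_mem_HSet (ptH hX x).2 (Subtype.prop _)
  · rw [ZFSet.cardinalMk_coe_sort]
    simpa using (mem_HSet_iff.1 hX).1

theorem isEntry_iff {R f : HSet χ} {n : ℕ} {g : X → ℝ}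
    (hg : ∀ t x, Rel R (nat n) (natTriple t) (ptH hX x) ↔ frac t < g x) :
    IsEntry ⟨X, hX⟩ (tripleSet fun _ => True) R (nat n) f ↔ (f : ZFSet.{u}) = funSet g := by
  have key : ∀ p : HSet χ, (∃ x, x ∈ (⟨X, hX⟩ : HSet χ) ∧ ∃ r, p = opair x r ∧
      ∀ t, t ∈ r ↔ t ∈ (tripleSet fun _ => True : HSet χ) ∧ Rel R (nat n) t x) ↔
      (p : ZFSet.{u}) ∈ funSet g := by
    intro p
    have hr : ∀ x (r : HSet χ), (∀ t, t ∈ r ↔ t ∈ (tripleSet fun _ => True : HSet χ) ∧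
        Rel R (nat n) t (ptH hX x)) ↔ r = tripleSet fun t => frac t < g x := by
      intro x r
      have h : ∀ t, (t ∈ (tripleSet fun _ => True : HSet χ) ∧ Rel R (nat n) t (ptH hX x)) ↔
          t ∈ (tripleSet fun t => frac t < g x : HSet χ) := by
        intro t
        simp only [mem_tripleSet]
        constructor
        · rintro ⟨⟨t, -, rfl⟩, ht⟩
          exact ⟨t, (hg _ _).1 ht, rfl⟩
        · rintro ⟨t, ht, rfl⟩
          exact ⟨⟨t, trivial, rfl⟩, (hg _ _).2 ht⟩
      simp only [h]
      exact ⟨HSet.ext, fun h t => by rw [h]⟩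
    rw [funSet, ZFSet.mem_range]
    constructor
    · rintro ⟨x, hx, r, rfl, ht⟩
      obtain ⟨x, rfl⟩ := exists_eq_ptH hX hx
      rw [hr] at ht
      subst ht
      exact ⟨x, rfl⟩
    · rintro ⟨x, hx⟩
      exact ⟨_, ptH_mem hX x, tripleSet fun t => frac t < g x, Subtype.ext hx.symm, (hr _ _).2 rfl⟩
  unfold IsEntry
  simp only [key]
  constructor
  · intro h
    exact congrArg Subtype.val (HSet.ext (b := ⟨funSet g, funSet_mem_HSet (χ := χ) hX g⟩) h)
  · intro h p
    rw [← h]; rfl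

theorem splitsTriples_seqSet {f : ℕ → X → ℝ}
    (hf : ∀ t : Fin 3 → X, Function.Injective t → ∃ n i j, f n (t i) ≠ f n (t j)) :
    SplitsTriples ⟨X, hX⟩ omega (tripleSet fun _ => True) (seqSet hX f) := by
  have key : ∀ n (x y : X), f n x ≠ f n y →
      ∃ t, ¬ (Rel (seqSet hX f) (nat n) (natTriple t) (ptH hX x) ↔
        Rel (seqSet hX f) (nat n) (natTriple t) (ptH hX y)) := by
    intro n x y h
    simp only [rel_seqSet]
    rcases h.lt_or_gt with h | h
    · obtain ⟨t, h1, h2⟩ := exists_frac_btwn h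
      exact ⟨t, fun h => h1.not_gt (h.2 h2)⟩
    · obtain ⟨t, h1, h2⟩ := exists_frac_btwn h
      exact ⟨t, fun h => h1.not_gt (h.1 h2)⟩
  intro x hx y hy z hz hxy hyz hxz
  obtain ⟨x, rfl⟩ := exists_eq_ptH hX hx
  obtain ⟨y, rfl⟩ := exists_eq_ptH hX hy
  obtain ⟨z, rfl⟩ := exists_eq_ptH hX hz
  rw [ptH_inj] at hxy hyz hxz
  have hinj : Function.Injective ![x, y, z] := by
    intro i j
    fin_cases i <;> fin_cases j <;> simp [hxy, hyz, hxz, Ne.symm hxy, Ne.symm hyz, Ne.symm hxz]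
  obtain ⟨n, i, j, hn⟩ := hf _ hinj
  have h : f n x ≠ f n y ∨ f n y ≠ f n z := by
    by_contra! h
    have h0 : ∀ i, f n (![x, y, z] i) = f n y := by
      intro i
      fin_cases i
      · exact h.1
      · rfl
      · exact h.2.symm
    exact hn ((h0 i).trans (h0 j).symm)
  refine ⟨nat n, nat_mem_omega n, ?_⟩
  rcases h with h | h
  · obtain ⟨t, ht⟩ := key n _ _ h
    exact ⟨_, natTriple_mem t, Or.inl ht⟩
  · obtain ⟨t, ht⟩ := key n _ _ h
    exact ⟨_, natTriple_mem t, Or.inr ht⟩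

variable [TopologicalSpace X]

theorem isFunSeq_seqSet (hτ : topologySet X ∈ HSet χ) {L : HSet χ}
    (hL : ∀ s t, opair (natTriple s) (natTriple t) ∈ L ↔ frac s < frac t) {f : ℕ → X → ℝ}
    (hf : ∀ n, Continuous (f n)) :
    IsFunSeq ⟨X, hX⟩ ⟨topologySet X, hτ⟩ omega (tripleSet fun _ => True) L (seqSet hX f) := by
  refine ⟨fun n hn x hx => ?_, fun n hn t ht => ?_⟩
  · obtain ⟨n, rfl⟩ := mem_omega.1 hn
    obtain ⟨x, rfl⟩ := exists_eq_ptH hX hx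
    simp only [exists_mem_triples, rel_seqSet]
    refine ⟨?_, ?_, fun t ht => ?_⟩
    · obtain ⟨t, -, ht⟩ := exists_frac_btwn (sub_one_lt (f n x))
      exact ⟨t, ht⟩
    · obtain ⟨t, ht, -⟩ := exists_frac_btwn (lt_add_one (f n x))
      exact ⟨t, ht.not_gt⟩
    · obtain ⟨t, -, rfl⟩ := mem_tripleSet.1 ht
      simp only [rel_seqSet, hL]
      exact ⟨exists_frac_btwn, fun ⟨s, h1, h2⟩ => h1.trans h2⟩
  · obtain ⟨n, rfl⟩ := mem_omega.1 hn
    obtain ⟨t, -, rfl⟩ := mem_tripleSet.1 ht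
    constructor
    · obtain ⟨U, hU, hUV⟩ := exists_mem_topologySet hX hτ
        (isOpen_lt continuous_const (hf n) : IsOpen {x | frac t < f n x})
      refine ⟨U, hU, fun x hx => ?_⟩
      obtain ⟨x, rfl⟩ := exists_eq_ptH hX hx
      rw [hUV, rel_seqSet]; rfl
    · obtain ⟨U, hU, hUV⟩ := exists_mem_topologySet hX hτ
        (isOpen_lt (hf n) continuous_const : IsOpen {x | f n x < frac t})
      refine ⟨U, hU, fun x hx => ?_⟩
      obtain ⟨x, rfl⟩ := exists_eq_ptH hX hx
      simp only [exists_mem_triples, rel_seqSet, hL, hUV, not_lt, Set.mem_ofPred_eq]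
      constructor
      · intro h
        obtain ⟨s, h1, h2⟩ := exists_frac_btwn h
        exact ⟨s, h2, h1.le⟩
      · exact fun ⟨s, h1, h2⟩ => h2.trans_lt h1

theorem IsFunSeq.exists_continuous (hτ : topologySet X ∈ HSet χ) {L R : HSet χ}
    (hL : ∀ s t, opair (natTriple s) (natTriple t) ∈ L ↔ frac s < frac t)
    (hR : IsFunSeq ⟨X, hX⟩ ⟨topologySet X, hτ⟩ omega (tripleSet fun _ => True) L R) (n : ℕ) :
    ∃ g : X → ℝ, Continuous g ∧
      ∀ t x, Rel R (nat n) (natTriple t) (ptH hX x) ↔ frac t < g x := by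
  have hcut : ∀ x : X, ∃ r : ℝ, ∀ t, Rel R (nat n) (natTriple t) (ptH hX x) ↔ frac t < r := by
    intro x
    have h := hR.1 _ (nat_mem_omega n) _ (ptH_mem hX x)
    simp only [exists_mem_triples] at h
    refine exists_real_of_cut h.1 h.2.1 fun t => ?_
    simp only [h.2.2 _ (natTriple_mem t), hL]
  choose g hg using hcut
  refine ⟨g, ?_, fun t x => hg x t⟩
  have hlow : ∀ t, IsOpen {x | frac t < g x} := fun t => by
    obtain ⟨⟨U, hU, hUx⟩, -⟩ := hR.2 _ (nat_mem_omega n) _ (natTriple_mem t)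
    have h := isOpen_of_mem_topologySet hX hτ hU
    simpa only [hUx _ (ptH_mem hX _), hg] using h
  have hup : ∀ t, IsOpen {x | g x < frac t} := fun t => by
    obtain ⟨-, U, hU, hUx⟩ := hR.2 _ (nat_mem_omega n) _ (natTriple_mem t)
    have h := isOpen_of_mem_topologySet hX hτ hU
    have he : ∀ x, (∃ s, frac s < frac t ∧ ¬ frac s < g x) ↔ g x < frac t := fun x => by
      constructor
      · exact fun ⟨s, h1, h2⟩ => (not_lt.1 h2).trans_lt h1
      · intro h
        obtain ⟨s, h1, h2⟩ := exists_frac_btwn h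
        exact ⟨s, h2, h1.not_gt⟩
    simpa only [hUx _ (ptH_mem hX _), exists_mem_triples, hg, hL, he] using h
  rw [OrderTopology.continuous_iff]
  refine fun a => ⟨?_, ?_⟩
  · have : g ⁻¹' Set.Ioi a = ⋃ t ∈ {t | a < frac t}, {x | frac t < g x} := by
      ext x
      simp only [Set.mem_preimage, Set.mem_Ioi, Set.mem_iUnion, Set.mem_ofPred_eq, exists_prop]
      exact ⟨exists_frac_btwn, fun ⟨t, h1, h2⟩ => h1.trans h2⟩
    rw [this]
    exact isOpen_biUnion fun t _ => hlow t
  · have : g ⁻¹' Set.Iio a = ⋃ t ∈ {t | frac t < a}, {x | g x < frac t} := by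
      ext x
      simp only [Set.mem_preimage, Set.mem_Iio, Set.mem_iUnion, Set.mem_ofPred_eq, exists_prop]
      exact ⟨fun h => (exists_frac_btwn h).imp fun _ h => h.symm, fun ⟨t, h1, h2⟩ => h2.trans h1⟩
    rw [this]
    exact isOpen_biUnion fun t _ => hup t

end Sequences

/-! ### The submodel contains a splitting sequence -/

section Submodel

open HSet

variable {χ : Cardinal.{u}} [hχ : Fact (Cardinal.aleph0 < χ)]

theorem exists_mem_of_spaceSet_mem (M : setLang.ElementarySubstructure (HSet χ)) {X : ZFSet.{u}}
    [TopologicalSpace X] (h : spaceSet X ∈ elems M) :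
    ∃ (hX : X ∈ HSet χ) (hτ : topologySet X ∈ HSet χ), (⟨X, hX⟩ : HSet χ) ∈ M ∧
      (⟨topologySet X, hτ⟩ : HSet χ) ∈ M := by
  obtain ⟨p, hpM, hp⟩ := h
  have h1 : {X, topologySet X} ∈ HSet χ :=
    mem_HSet_of_mem p.2 (by rw [hp, spaceSet, ZFSet.pair, ZFSet.mem_pair]; exact Or.inr rfl)
  have hX : X ∈ HSet χ := mem_HSet_of_mem h1 (ZFSet.mem_pair.2 (Or.inl rfl))
  have hτ : topologySet X ∈ HSet χ := mem_HSet_of_mem h1 (ZFSet.mem_pair.2 (Or.inr rfl))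
  have hpe : p = opair ⟨X, hX⟩ ⟨topologySet X, hτ⟩ := Subtype.ext hp
  refine ⟨hX, hτ, ?_, ?_⟩
  · obtain ⟨x, hxM, y, hy⟩ := exists_mem_of_dfn M (α := Fin 1)
      (P := fun v x => ∃ y, v 0 = opair x y)
      (Dfn.ex (Dfn.eq (DfnOp.var _) (DfnOp.opair (DfnOp.var _) (DfnOp.var _)))) ![p]
      (by simpa using hpM) ⟨_, _, hpe⟩
    rwa [(opair_inj.1 (hpe.symm.trans hy)).1]
  · obtain ⟨y, hyM, x, hx⟩ := exists_mem_of_dfn M (α := Fin 1)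
      (P := fun v y => ∃ x, v 0 = opair x y)
      (Dfn.ex (Dfn.eq (DfnOp.var _) (DfnOp.opair (DfnOp.var _) (DfnOp.var _)))) ![p]
      (by simpa using hpM) ⟨_, _, hpe⟩
    rwa [(opair_inj.1 (hpe.symm.trans hx)).2]

/-- If some sequence of continuous functions splits all triples of distinct points of `X`, then so
do the continuous functions in an elementary submodel containing the space `X`. -/
theorem exists_ne_of_mem (M : setLang.ElementarySubstructure (HSet χ)) {X : ZFSet.{u}}
    [TopologicalSpace X] (hXM : spaceSet X ∈ elems M) {f : ℕ → X → ℝ}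
    (hf : ∀ n, Continuous (f n))
    (hsplit : ∀ t : Fin 3 → X, Function.Injective t → ∃ n i j, f n (t i) ≠ f n (t j))
    {x y z : X} (hxy : x ≠ y) (hyz : y ≠ z) (hxz : x ≠ z) :
    ∃ g : X → ℝ, Continuous g ∧ funSet g ∈ elems M ∧ (g x ≠ g y ∨ g y ≠ g z) := by
  obtain ⟨hX, hτ, hXm, hτm⟩ := exists_mem_of_spaceSet_mem M hXM
  obtain ⟨L, hLM, hL⟩ := exists_ratLt_mem M
  have hparam : ∀ i, (![⟨X, hX⟩, ⟨topologySet X, hτ⟩, omega, tripleSet fun _ => True, L] :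
      Fin 5 → HSet χ) i ∈ M := by
    intro i
    fin_cases i
    exacts [hXm, hτm, omega_mem M, tripleSet_mem M, hLM]
  obtain ⟨R, hRM, hR, hRsplit⟩ := exists_mem_of_dfn M (α := Fin 5)
    (P := fun v R => IsFunSeq (v 0) (v 1) (v 2) (v 3) (v 4) R ∧ SplitsTriples (v 0) (v 2) (v 3) R)
    ((dfn_isFunSeq _ _ _ _ _ _).and (dfn_splitsTriples _ _ _ _)) _ hparam
    ⟨seqSet hX f, isFunSeq_seqSet hX hτ hL hf, splitsTriples_seqSet hX hsplit⟩
  obtain ⟨n, hn, t, ht, hne⟩ := hRsplit _ (ptH_mem hX x) _ (ptH_mem hX y) _ (ptH_mem hX z)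
    (by rwa [ptH_inj]) (by rwa [ptH_inj]) (by rwa [ptH_inj])
  obtain ⟨n, rfl⟩ := mem_omega.1 hn
  obtain ⟨t, -, rfl⟩ := mem_tripleSet.1 ht
  obtain ⟨g, hgc, hg⟩ := IsFunSeq.exists_continuous hX hτ hL hR n
  refine ⟨g, hgc, ?_, ?_⟩
  · have hparam' : ∀ i, (![⟨X, hX⟩, tripleSet fun _ => True, R, nat n] : Fin 4 → HSet χ) i ∈ M := by
      intro i
      fin_cases i
      exacts [hXm, tripleSet_mem M, hRM, nat_mem M n]
    obtain ⟨F, hFM, hF⟩ := exists_mem_of_dfn M (α := Fin 4)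
      (P := fun v F => IsEntry (v 0) (v 1) (v 2) (v 3) F) (dfn_isEntry _ _ _ _ _) _ hparam'
      ⟨⟨funSet g, funSet_mem_HSet hX g⟩, (isEntry_iff hX hg).2 rfl⟩
    exact ⟨F, hFM, (isEntry_iff hX hg).1 hF⟩
  · by_contra! h
    simp only [hg, h.1, h.2, iff_self, not_true, or_self] at hne

end Submodel

end SubmodelTop

end

theorem theorem3p1 (χ : Cardinal.{u}) (hχ : χ.IsRegular) (hχ' : Cardinal.aleph0 < χ)
    (X : ZFSet.{u}) [TopologicalSpace X] [CompactSpace X] [T2Space X]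
    [TopologicalSpace.SeparableSpace X] (hX : SubmodelTop.MonotonicallyNormal X)
    (M : SubmodelTop.setLang.ElementarySubstructure (SubmodelTop.HSet χ))
    (hM : (SubmodelTop.elems M).Countable) (hXM : SubmodelTop.spaceSet X ∈ SubmodelTop.elems M) :
    ∀ K ∈ (SubmodelTop.modelSetoid M X).classes, K.encard ≤ 2 := by
  intro K hK
  obtain ⟨c, rfl⟩ := hK
  by_contra! hcard
  have : Fact (Cardinal.aleph0 < χ) := ⟨hχ'⟩
  obtain ⟨f, hf, hsplit⟩ := SubmodelTop.exists_seq_continuous_splitting hX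
  obtain ⟨S, hS, hS3⟩ := Set.exists_subset_encard_eq
    (show (3 : ℕ∞) ≤ _ from Order.add_one_le_of_lt hcard)
  obtain ⟨x, y, z, hxy, hxz, hyz, rfl⟩ := Set.encard_eq_three.1 hS3
  have hx := hS (Or.inl rfl)
  have hy := hS (Or.inr (Or.inl rfl))
  have hz := hS (Or.inr (Or.inr rfl))
  obtain ⟨g, hg, hgM, hne⟩ := SubmodelTop.exists_ne_of_mem M hXM hf hsplit hxy hyz hxz
  have hgx : g x = g c := hx g hg hgM
  have hgy : g y = g c := hy g hg hgM
  have hgz : g z = g c := hz g hg hgM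
  rcases hne with h | h
  · exact h (hgx.trans hgy.symm)
  · exact h (hgy.trans hgz.symm)
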